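/- Let $n$ be a positive integer, let $0<\alpha<n$, and let $p$ be a real number with $p\le \frac{n+\alpha}{n-\alpha}$ (the subcritical and critical cases). Let $x^o\in\mathbb R^n$ and let $u$ be a positive real-valued function on $\mathbb R^n\setminus\{x^o\}$ that solves the integral equation $$u(x)=\int_{\mathbb R^n}\frac{u(y)^p}{|x-y|^{n-\alpha}}\,dy\qquad\text{for every } x\neq x^o,$$ where the integral converges for every $x\ne x^o$. Suppose that $u$ has exactly one singularity, located at $x^o$: that is, $u$ is unbounded in every punctured neighbourhood of $x^o$, while every point $z\neq x^o$ has a neighbourhood on which $u$ is bounded. Then $u$ is radially symmetric about $x^o$ and strictly decreasing in $|x-x^o|$: there is a strictly decreasing function $\varphi:(0,\infty)\to\mathbb R$ such that $u(x)=\varphi(|x-x^o|)$ for all $x\neq x^o$. -/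

import Mathlib

open Filter Topology MeasureTheory

/-- `u` is a positive solution of `u(x) = ∫_{ℝⁿ} u(y)^p / |x - y|^(n-α) dy`, the equation being
required at every point `x` other than `x₀` (where `u` may blow up; the value of the real-valued
function `u` at the single point `x₀` carries no information). Convergence of the integral is part
of being a solution. -/
structure IsPositiveSolutionOff (n : ℕ) (α p : ℝ) (x₀ : EuclideanSpace ℝ (Fin n))
    (u : EuclideanSpace ℝ (Fin n) → ℝ) : Prop where
  pos : ∀ x, x ≠ x₀ → 0 < u x
  integrable : ∀ x, x ≠ x₀ →
    Integrable (fun y : EuclideanSpace ℝ (Fin n) => u y ^ p / ‖x - y‖ ^ ((n : ℝ) - α)) volume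
  eq : ∀ x, x ≠ x₀ →
    u x = ∫ y : EuclideanSpace ℝ (Fin n), u y ^ p / ‖x - y‖ ^ ((n : ℝ) - α)

/-- `z` is a singularity of `u`: `u` is unbounded on every punctured neighbourhood of `z`. -/
def IsSingularPoint {n : ℕ} (u : EuclideanSpace ℝ (Fin n) → ℝ)
    (z : EuclideanSpace ℝ (Fin n)) : Prop :=
  ¬ ∃ M : ℝ, ∀ᶠ x in 𝓝[≠] z, |u x| ≤ M

/-!
The proof is by the method of moving spheres. Write `s = n - α`, and for a centre `c ≠ x₀` and a
radius `R` let `u_R(y) = (R / |y - c|)ˢ u(yᴿ)` be the Kelvin transform of `u`, where `yᴿ` is the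
inverse of `y` in the sphere. The main claim (`SingularRieszSolution.kelvinLE`) is that `u_R ≤ u`
outside the sphere as long as the ball does not reach `x₀`, that is, for `R < |x₀ - c|`.

Folding the integral equation by the inversion gives, outside the sphere,
`u - u_R = ∫ K (uᵖ - (R / |z - c|)^(n + α - p s) u_Rᵖ)`, integrated over the exterior, with a kernel
`K ≥ 0` (`RieszSolution.sub_kelvin_eq`). The exponent `n + α - p s` is nonnegative exactly because
`p` is subcritical or critical, so that the weight is at most `1`. Three facts then carry the main
claim.
* If `u_R ≤ u` outside an annulus of small volume around the sphere, then `u_R ≤ u` in the annulus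
  too: there `t ↦ tᵖ` is Lipschitz on the range of `u`, and the equation halves the supremum of
  `u_R - u` (`exists_narrow_region`). Working with suprema instead of `Lᵠ` norms is possible since
  `u` is continuous, hence bounded above and below, away from `x₀`.
* For small `R` the hypothesis of this principle follows from the lower bound `u(y) ≥ C |y - c|⁻ˢ`
  at large distance (`exists_kelvinLE_of_small_radius`).
* If `u_R ≤ u` for some `R < |x₀ - c|`, then `u - u_R ≥ ε |y - c|⁻ˢ` away from the sphere, since `u`
  is unbounded near `x₀` and `u_R` is not (`exists_kelvin_add_le`); so the radius can be increased
  (`exists_kelvinLE_of_kelvinLE`).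

Given `|y - x₀| ≤ |z - x₀|`, there are arbitrarily large spheres which do not enclose `x₀` and whose
inversion maps `y` to `z`. In the limit the Kelvin factor tends to `1` and the claim becomes
`u z ≤ u y` (`le_of_dist_le`), so `u` is radial and nonincreasing. Strictness (`lt_of_dist_lt`)
follows by reflecting the integral equation in the bisector of `y` and `z`.

For `p ≤ 0` there is nothing to show: `uᵖ` would be bounded near `x₀`, hence so would be `u`
(`RieszSolution.exponent_pos_of_unbounded`).
-/

open Metric Set Module EuclideanGeometry

/-! ### Riesz kernels and potentials -/

section Kernel

variable {E : Type*} [NormedAddCommGroup E] [InnerProductSpace ℝ E] [FiniteDimensional ℝ E]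
  [MeasurableSpace E] [BorelSpace E]

theorem integrableOn_ball_dist_rpow_neg {s : ℝ} (hs : 0 < s) (hsd : s < finrank ℝ E) (y : E)
    (r : ℝ) : IntegrableOn (fun z => dist y z ^ (-s)) (ball y r) := by
  have hd : 0 < finrank ℝ E := by
    have : (0 : ℝ) < finrank ℝ E := hs.trans hsd
    exact_mod_cast this
  have : Nontrivial E := Module.nontrivial_of_finrank_pos hd
  have h0 : IntegrableOn (fun x : E => ‖x‖ ^ (-s)) (ball (0 : E) r) := by
    rw [integrableOn_fun_norm_addHaar volume (f := fun t : ℝ => t ^ (-s))]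
    have h1 : IntegrableOn (fun t : ℝ => t ^ ((finrank ℝ E : ℝ) - 1 - s)) (Ioo 0 r) := by
      rcases le_or_gt r 0 with hr | hr
      · simp [Ioo_eq_empty_of_le hr]
      · exact (intervalIntegral.integrableOn_Ioo_rpow_iff hr).2 (by linarith)
    refine h1.congr_fun (fun t ht => ?_) measurableSet_Ioo
    have e : ((finrank ℝ E - 1 : ℕ) : ℝ) = (finrank ℝ E : ℝ) - 1 := by
      rw [Nat.cast_sub hd]; simp
    simp only [smul_eq_mul]
    rw [← Real.rpow_natCast, ← Real.rpow_add ht.1, e]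
    ring_nf
  have hm : MeasurePreserving (fun z : E => z - y) volume volume :=
    measurePreserving_sub_right volume y
  have h2 := (hm.integrableOn_comp_preimage
    (Homeomorph.subRight y).measurableEmbedding).2 h0
  have hpre : (fun z : E => z - y) ⁻¹' ball (0 : E) r = ball y r := by
    ext z; simp [dist_eq_norm]
  rw [hpre] at h2
  refine h2.congr_fun (fun z _ => ?_) measurableSet_ball
  simp [dist_comm y z, dist_eq_norm]

theorem setIntegral_ball_dist_rpow_neg (s : ℝ) (y : E) (r : ℝ) :
    ∫ z in ball y r, dist y z ^ (-s) = ∫ z in ball (0 : E) r, dist 0 z ^ (-s) := by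
  have hm : MeasurePreserving (fun z : E => z - y) volume volume :=
    measurePreserving_sub_right volume y
  have h2 := hm.setIntegral_preimage_emb
    (Homeomorph.subRight y).measurableEmbedding (fun z => dist 0 z ^ (-s)) (ball (0 : E) r)
  have hpre : (fun z : E => z - y) ⁻¹' ball (0 : E) r = ball y r := by
    ext z; simp [dist_eq_norm]
  rw [hpre] at h2
  rw [← h2]
  refine setIntegral_congr_fun measurableSet_ball (fun z _ => ?_)
  simp [dist_eq_norm, norm_sub_rev y z]

theorem tendsto_setIntegral_ball_dist_rpow_neg {s : ℝ} (hs : 0 < s) (hsd : s < finrank ℝ E) :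
    Tendsto (fun k : ℕ => ∫ z in ball (0 : E) (1 / ((k : ℝ) + 1)), dist 0 z ^ (-s)) atTop
      (𝓝 0) := by
  have h := tendsto_setIntegral_of_antitone (μ := (volume : Measure E))
    (f := fun z => dist (0 : E) z ^ (-s))
    (s := fun k : ℕ => ball (0 : E) (1 / ((k : ℝ) + 1))) (fun k => measurableSet_ball)
    (fun i j hij => ball_subset_ball (by gcongr)) ⟨0, integrableOn_ball_dist_rpow_neg hs hsd _ _⟩
  have hI : (⋂ k : ℕ, ball (0 : E) (1 / ((k : ℝ) + 1))) = {0} := by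
    ext z
    simp only [mem_iInter, mem_ball, dist_zero_right, mem_singleton_iff]
    constructor
    · intro h
      by_contra hz
      obtain ⟨k, hk⟩ := exists_nat_one_div_lt (norm_pos_iff.2 hz)
      exact absurd (h k) (not_lt.2 hk.le)
    · rintro rfl k
      rw [norm_zero]; positivity
  have hz : ∫ z in ({0} : Set E), dist (0 : E) z ^ (-s) = 0 := by
    rw [integral_singleton]
    simp [Real.zero_rpow (neg_ne_zero.2 hs.ne')]
  rw [hI, hz] at h
  exact h

/-- Uniform absolute continuity of the Riesz kernels: on sets of small measure, the integral of
`|y - z|⁻ˢ` is small uniformly in the pole `y`. -/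
theorem exists_setIntegral_dist_rpow_neg_le {s : ℝ} (hs : 0 < s) (hsd : s < finrank ℝ E) {ε : ℝ}
    (hε : 0 < ε) : ∃ δ : ℝ, 0 < δ ∧ ∀ A : Set E, MeasurableSet A → volume A ≤ ENNReal.ofReal δ →
      ∀ y : E, IntegrableOn (fun z => dist y z ^ (-s)) A ∧ ∫ z in A, dist y z ^ (-s) ≤ ε := by
  obtain ⟨k, hk⟩ := ((tendsto_setIntegral_ball_dist_rpow_neg hs hsd).eventually_lt_const
    (half_pos hε)).exists
  set r : ℝ := 1 / ((k : ℝ) + 1) with hr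
  have hr0 : 0 < r := by positivity
  refine ⟨ε / 2 * r ^ s, by positivity, fun A hA hvol y => ?_⟩
  have hfin : volume A ≠ ⊤ := ne_top_of_le_ne_top ENNReal.ofReal_ne_top hvol
  have hreal : volume.real A ≤ ε / 2 * r ^ s :=
    ENNReal.toReal_le_of_le_ofReal (by positivity) hvol
  have hball := integrableOn_ball_dist_rpow_neg hs hsd y r
  have hi1 : Integrable ((ball y r).indicator fun z => dist y z ^ (-s)) :=
    (integrable_indicator_iff measurableSet_ball).2 hball
  have hi2 : IntegrableOn (fun _ : E => r ^ (-s)) A := integrableOn_const hfin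
  have hle : ∀ z,
      dist y z ^ (-s) ≤ (ball y r).indicator (fun z => dist y z ^ (-s)) z + r ^ (-s) := by
    intro z
    by_cases hz : z ∈ ball y r
    · rw [indicator_of_mem hz]
      have : (0 : ℝ) ≤ r ^ (-s) := by positivity
      linarith
    · rw [indicator_of_notMem hz, zero_add]
      have : r ≤ dist y z := by simpa [dist_comm] using hz
      exact Real.rpow_le_rpow_of_nonpos hr0 this (by linarith)
  have hmeas : Measurable fun z : E => dist y z ^ (-s) := by fun_prop
  have hi : IntegrableOn (fun z => dist y z ^ (-s)) A := by
    refine Integrable.mono' (hi1.integrableOn.add hi2) hmeas.aestronglyMeasurable ?_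
    refine Eventually.of_forall fun z => ?_
    rw [Real.norm_of_nonneg (by positivity)]
    exact hle z
  refine ⟨hi, ?_⟩
  calc ∫ z in A, dist y z ^ (-s)
      ≤ ∫ z in A, ((ball y r).indicator (fun z => dist y z ^ (-s)) z + r ^ (-s)) :=
        setIntegral_mono hi (hi1.integrableOn.add hi2) hle
    _ = (∫ z in A, (ball y r).indicator (fun z => dist y z ^ (-s)) z) + ∫ z in A, r ^ (-s) :=
        integral_add hi1.integrableOn hi2
    _ ≤ (∫ z, (ball y r).indicator (fun z => dist y z ^ (-s)) z) + volume.real A * r ^ (-s) := by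
        gcongr
        · refine Eventually.of_forall fun z => ?_
          exact indicator_nonneg (fun _ _ => by positivity) _
        · exact Measure.restrict_le_self
        · simp
    _ ≤ ε / 2 + (ε / 2 * r ^ s) * r ^ (-s) := by
        gcongr
        rw [integral_indicator measurableSet_ball, setIntegral_ball_dist_rpow_neg]
        exact hk.le
    _ = ε := by
        rw [mul_assoc, ← Real.rpow_add hr0]; simp

/-- A Riesz potential is continuous at every point near which its density is bounded: replacing
the kernel by its truncation at height `ρ⁻ˢ` gives continuous functions which converge locally
uniformly. -/
theorem continuousAt_riesz_potential {s : ℝ} (hs : 0 < s) (hsd : s < finrank ℝ E) {f : E → ℝ}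
    {x : E} {r M : ℝ} (hr : 0 < r) (hf : ∀ᵐ z, 0 ≤ f z) (hM : ∀ᵐ z, z ∈ ball x r → f z ≤ M)
    (hint : ∀ y ∈ ball x r, Integrable fun z => f z * dist y z ^ (-s)) :
    ContinuousAt (fun y => ∫ z, f z * dist y z ^ (-s)) x := by
  have hd : 0 < finrank ℝ E := by
    have : (0 : ℝ) < finrank ℝ E := hs.trans hsd
    exact_mod_cast this
  have : Nontrivial E := Module.nontrivial_of_finrank_pos hd
  have hne : ∀ y : E, ∀ᵐ z : E, z ≠ y := fun y =>
    compl_mem_ae_iff.2 (measure_singleton y)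
  have hM1 : ∀ᵐ z, z ∈ ball x r → f z ≤ |M| + 1 := hM.mono fun z h hz =>
    (h hz).trans (by linarith [le_abs_self M])
  have hfm : AEStronglyMeasurable f volume := by
    have h1 := (hint x (mem_ball_self hr)).aestronglyMeasurable
    have h2 : AEStronglyMeasurable (fun z => dist x z ^ s) volume :=
      (by fun_prop : Measurable fun z : E => dist x z ^ s).aestronglyMeasurable
    refine (h1.mul h2).congr ?_
    filter_upwards [hne x] with z hz
    have hp : 0 < dist x z := dist_pos.2 hz.symm
    simp only [Pi.mul_apply]
    rw [mul_assoc, ← Real.rpow_add hp]; simp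
  refine continuousAt_of_locally_uniform_approx_of_continuousAt fun W hW => ?_
  obtain ⟨ε, hε, hεW⟩ := Metric.mem_uniformity_dist.1 hW
  have hM0 : 0 < |M| + 1 := by positivity
  obtain ⟨k, hk, hkr⟩ := (((tendsto_setIntegral_ball_dist_rpow_neg hs hsd).eventually_lt_const
    (show 0 < ε / (|M| + 1) by positivity)).and
    ((tendsto_one_div_add_atTop_nhds_zero_nat (𝕜 := ℝ)).eventually_lt_const (half_pos hr))).exists
  set ρ : ℝ := 1 / ((k : ℝ) + 1) with hρ
  have hρ0 : 0 < ρ := by positivity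
  -- the truncated kernel
  set T : E → E → ℝ := fun y z => max (dist y z) ρ ^ (-s) with hT
  have hT0 : ∀ y z, 0 ≤ T y z := fun y z => by
    have : 0 < max (dist y z) ρ := lt_max_of_lt_right hρ0
    positivity
  have hTk : ∀ y z, z ≠ y → T y z ≤ dist y z ^ (-s) := fun y z hz =>
    Real.rpow_le_rpow_of_nonpos (dist_pos.2 hz.symm) (le_max_left _ _) (by linarith)
  have hTm : ∀ y, AEStronglyMeasurable (fun z => T y z) volume := fun y =>
    (by fun_prop : Measurable fun z : E => max (dist y z) ρ ^ (-s)).aestronglyMeasurable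
  have hTint : ∀ y ∈ ball x r, Integrable fun z => f z * T y z := fun y hy => by
    refine Integrable.mono' (hint y hy) (hfm.mul (hTm y)) ?_
    filter_upwards [hf, hne y] with z hz hzy
    rw [Real.norm_of_nonneg (mul_nonneg hz (hT0 _ _))]
    exact mul_le_mul_of_nonneg_left (hTk y z hzy) hz
  refine ⟨ball x (r / 2), ball_mem_nhds x (half_pos hr), fun y => ∫ z, f z * T y z, ?_,
    fun y hy => hεW ?_⟩
  · refine continuousAt_of_dominated (bound := fun z => f z * dist x z ^ (-s) * 2 ^ s)
      (Eventually.of_forall fun y => hfm.mul (hTm y)) ?_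
      ((hint x (mem_ball_self hr)).mul_const _) ?_
    · filter_upwards [ball_mem_nhds x hρ0] with y hy
      filter_upwards [hf, hne x] with z hz hzx
      rw [Real.norm_of_nonneg (mul_nonneg hz (hT0 _ _)), mul_assoc]
      refine mul_le_mul_of_nonneg_left ?_ hz
      have hpos : 0 < max (dist x z) ρ := lt_max_of_lt_right hρ0
      have h1 : max (dist x z) ρ / 2 ≤ max (dist y z) ρ := by
        rw [div_le_iff₀ two_pos]
        refine max_le ?_ ?_
        · have := dist_triangle x y z
          have hxy : dist x y < ρ := by rw [dist_comm]; exact hy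
          linarith [le_max_left (dist y z) ρ, le_max_right (dist y z) ρ]
        · linarith [le_max_right (dist y z) ρ]
      calc T y z ≤ (max (dist x z) ρ / 2) ^ (-s) :=
            Real.rpow_le_rpow_of_nonpos (by positivity) h1 (by linarith)
        _ = T x z * 2 ^ s := by
            rw [Real.div_rpow hpos.le two_pos.le, Real.rpow_neg two_pos.le, div_inv_eq_mul]
        _ ≤ dist x z ^ (-s) * 2 ^ s := by gcongr; exact hTk x z hzx
    · refine Eventually.of_forall fun z => ?_
      refine ContinuousAt.mul continuousAt_const ?_
      refine ContinuousAt.rpow_const (by fun_prop) (Or.inl ?_)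
      exact (lt_max_of_lt_right hρ0).ne'
  · have hyr : y ∈ ball x r := ball_subset_ball (by linarith) hy
    have hbi := integrableOn_ball_dist_rpow_neg hs hsd y ρ
    have hbi' : Integrable ((ball y ρ).indicator fun z => dist y z ^ (-s)) :=
      (integrable_indicator_iff measurableSet_ball).2 hbi
    rw [Real.dist_eq, ← integral_sub (hint y hyr) (hTint y hyr), abs_of_nonneg]
    · calc ∫ z, (f z * dist y z ^ (-s) - f z * T y z)
          ≤ ∫ z, (|M| + 1) * (ball y ρ).indicator (fun z => dist y z ^ (-s)) z := by
            refine integral_mono_ae ((hint y hyr).sub (hTint y hyr)) (hbi'.const_mul _) ?_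
            filter_upwards [hf, hM1] with z hz hzM
            by_cases hzb : z ∈ ball y ρ
            · rw [indicator_of_mem hzb]
              have hzx : z ∈ ball x r := by
                rw [mem_ball] at hzb hy ⊢
                linarith [dist_triangle z y x]
              have h1 : f z * dist y z ^ (-s) ≤ (|M| + 1) * dist y z ^ (-s) := by
                gcongr; exact hzM hzx
              have h2 : 0 ≤ f z * T y z := mul_nonneg hz (hT0 _ _)
              linarith
            · rw [indicator_of_notMem hzb]
              have : ρ ≤ dist y z := by simpa [dist_comm] using hzb
              simp [hT, max_eq_left this]
        _ < ε := by
            rw [integral_const_mul, integral_indicator measurableSet_ball,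
              setIntegral_ball_dist_rpow_neg, mul_comm]
            exact (lt_div_iff₀ hM0).1 hk
    · refine integral_nonneg_of_ae ?_
      filter_upwards [hf, hne y] with z hz hzy
      have := mul_le_mul_of_nonneg_left (hTk y z hzy) hz
      simpa using this

end Kernel

/-! ### Solutions off a point: bounds and continuity -/

section Solution

variable {E : Type*} [NormedAddCommGroup E] [InnerProductSpace ℝ E] [FiniteDimensional ℝ E]
  [MeasurableSpace E] [BorelSpace E]

/-- `u` is positive off `x₀` and there equals the Riesz potential of order `dim E - s` of `u ^ p`.
This is `IsPositiveSolutionOff` with the exponent `s = n - α` of the kernel as parameter, over an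
arbitrary Euclidean space. -/
structure RieszSolution (s p : ℝ) (x₀ : E) (u : E → ℝ) : Prop where
  s_pos : 0 < s
  s_lt : s < finrank ℝ E
  pos : ∀ x, x ≠ x₀ → 0 < u x
  integrable : ∀ x, x ≠ x₀ → Integrable fun z => u z ^ p * dist x z ^ (-s)
  eq : ∀ x, x ≠ x₀ → u x = ∫ z, u z ^ p * dist x z ^ (-s)

namespace RieszSolution

variable {s p : ℝ} {x₀ : E} {u : E → ℝ}

theorem nontrivial (h : RieszSolution s p x₀ u) : Nontrivial E := by
  have : (0 : ℝ) < finrank ℝ E := h.s_pos.trans h.s_lt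
  exact Module.nontrivial_of_finrank_pos (R := ℝ) (by exact_mod_cast this)

theorem ae_ne (h : RieszSolution s p x₀ u) (y : E) : ∀ᵐ z : E, z ≠ y := by
  have := h.nontrivial
  exact compl_mem_ae_iff.2 (measure_singleton y)

theorem ae_density_nonneg (h : RieszSolution s p x₀ u) : ∀ᵐ z, 0 ≤ u z ^ p := by
  filter_upwards [h.ae_ne x₀] with z hz
  exact Real.rpow_nonneg (h.pos z hz).le p

/-- A solution decays no faster than the fundamental solution `|y|⁻ˢ`, because the part of the
density near `x₀` alone contributes that much. -/
theorem exists_lower_bound (h : RieszSolution s p x₀ u) :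
    ∃ C r : ℝ, 0 < C ∧ 0 < r ∧ ∀ y, y ≠ x₀ → C * (dist y x₀ + r) ^ (-s) ≤ u y := by
  have hs := h.s_pos
  have := h.nontrivial
  obtain ⟨x₁, hx₁⟩ := exists_ne x₀
  set r := dist x₁ x₀ / 2 with hr
  have hr0 : 0 < r := half_pos (dist_pos.2 hx₁)
  have hpos : 0 < ∫ w in ball x₀ r, u w ^ p * dist x₁ w ^ (-s) := by
    rw [setIntegral_pos_iff_support_of_nonneg_ae]
    · refine (measure_ball_pos volume x₀ hr0).trans_le (measure_mono_ae ?_)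
      filter_upwards [h.ae_ne x₀] with w hw hwb
      refine ⟨?_, hwb⟩
      have hd : 0 < dist x₁ w := by
        have h1 : dist w x₀ < r := hwb
        linarith [dist_triangle x₁ w x₀]
      exact (mul_pos (Real.rpow_pos_of_pos (h.pos w hw) _) (Real.rpow_pos_of_pos hd _)).ne'
    · refine ae_restrict_of_ae ?_
      filter_upwards [h.ae_density_nonneg] with w hw
      exact mul_nonneg hw (by positivity)
    · exact (h.integrable x₁ hx₁).integrableOn
  refine ⟨r ^ s * ∫ w in ball x₀ r, u w ^ p * dist x₁ w ^ (-s), r, by positivity, hr0,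
    fun y hy => ?_⟩
  rw [h.eq y hy]
  calc r ^ s * (∫ w in ball x₀ r, u w ^ p * dist x₁ w ^ (-s)) * (dist y x₀ + r) ^ (-s)
      = ∫ w in ball x₀ r, r ^ s * (dist y x₀ + r) ^ (-s) * (u w ^ p * dist x₁ w ^ (-s)) := by
        rw [integral_const_mul]; ring
    _ ≤ ∫ w in ball x₀ r, u w ^ p * dist y w ^ (-s) := by
        refine setIntegral_mono_on_ae ((h.integrable x₁ hx₁).const_mul _).integrableOn
          (h.integrable y hy).integrableOn measurableSet_ball ?_
        filter_upwards [h.ae_density_nonneg, h.ae_ne y] with w hw hwy hwb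
        have h1 : dist w x₀ < r := hwb
        have hd : r ≤ dist x₁ w := by linarith [dist_triangle x₁ w x₀]
        have h2 : r ^ s * dist x₁ w ^ (-s) ≤ 1 := by
          calc r ^ s * dist x₁ w ^ (-s) ≤ r ^ s * r ^ (-s) := by
                gcongr ?_ * ?_
                exact Real.rpow_le_rpow_of_nonpos hr0 hd (by linarith)
            _ = 1 := by rw [← Real.rpow_add hr0]; simp
        have h3 : (dist y x₀ + r) ^ (-s) ≤ dist y w ^ (-s) := by
          refine Real.rpow_le_rpow_of_nonpos (dist_pos.2 hwy.symm) ?_ (by linarith)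
          linarith [dist_triangle y x₀ w, dist_comm x₀ w]
        have h4 : 0 ≤ (dist y x₀ + r) ^ (-s) := by positivity
        calc r ^ s * (dist y x₀ + r) ^ (-s) * (u w ^ p * dist x₁ w ^ (-s))
            = u w ^ p * ((r ^ s * dist x₁ w ^ (-s)) * (dist y x₀ + r) ^ (-s)) := by ring
          _ ≤ u w ^ p * (1 * dist y w ^ (-s)) := by gcongr
          _ = _ := by ring
    _ ≤ ∫ w, u w ^ p * dist y w ^ (-s) := by
        refine setIntegral_le_integral (h.integrable y hy) ?_
        filter_upwards [h.ae_density_nonneg] with w hw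
        exact mul_nonneg hw (by positivity)

/-- Where the density `u ^ p` is bounded, so is its potential `u`: the far part of the potential
is controlled by the value of `u` at one fixed point. -/
theorem bounded_of_density_bounded (h : RieszSolution s p x₀ u) {a : E} {r M : ℝ} (hr : 0 < r)
    (hM : ∀ z ∈ ball a (2 * r), z ≠ x₀ → u z ^ p ≤ M) :
    ∃ M' : ℝ, ∀ x ∈ ball a r, x ≠ x₀ → u x ≤ M' := by
  have hs := h.s_pos
  have := h.nontrivial
  obtain ⟨x₁, hx₁⟩ := exists_ne x₀
  set D := dist x₁ a + r with hD
  have hD0 : 0 ≤ D := by positivity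
  refine ⟨(|M| * ∫ z in ball (0 : E) (3 * r), dist 0 z ^ (-s)) + (D / r + 1) ^ s * u x₁,
    fun x hx hxx => ?_⟩
  have hK := integrableOn_ball_dist_rpow_neg hs h.s_lt x (3 * r)
  have hKi : Integrable ((ball x (3 * r)).indicator fun z => dist x z ^ (-s)) :=
    (integrable_indicator_iff measurableSet_ball).2 hK
  rw [h.eq x hxx, h.eq x₁ hx₁, ← setIntegral_ball_dist_rpow_neg s x (3 * r),
    ← integral_indicator measurableSet_ball, ← integral_const_mul, ← integral_const_mul,
    ← integral_add (hKi.const_mul _) ((h.integrable x₁ hx₁).const_mul _)]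
  refine integral_mono_ae (h.integrable x hxx)
    ((hKi.const_mul _).add ((h.integrable x₁ hx₁).const_mul _)) ?_
  filter_upwards [h.ae_density_nonneg, h.ae_ne x₀, h.ae_ne x₁] with z hz hz0 hz1
  have hd1 : 0 < dist x₁ z := dist_pos.2 hz1.symm
  by_cases hzb : z ∈ ball a (2 * r)
  · have hzx : z ∈ ball x (3 * r) := by
      rw [mem_ball] at *
      linarith [dist_triangle z a x, dist_comm a x]
    have h1 : u z ^ p * dist x z ^ (-s) ≤ |M| * dist x z ^ (-s) := by
      gcongr; exact (hM z hzb hz0).trans (le_abs_self M)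
    have h2 : 0 ≤ (D / r + 1) ^ s * (u z ^ p * dist x₁ z ^ (-s)) := by positivity
    simp only [indicator_of_mem hzx]
    linarith
  · have hxz : r ≤ dist x z := by
      rw [mem_ball, not_lt] at hzb
      rw [mem_ball] at hx
      linarith [dist_triangle z x a, dist_comm z x]
    have h1 : dist x₁ z ≤ (D / r + 1) * dist x z := by
      have : D ≤ D / r * dist x z := by
        rw [div_mul_eq_mul_div, le_div_iff₀ hr]; gcongr
      rw [mem_ball] at hx
      linarith [dist_triangle x₁ x z, dist_triangle x₁ a x, dist_comm a x]
    have hxz0 : 0 < dist x z := hr.trans_le hxz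
    have hq : 0 < D / r + 1 := by positivity
    have h2 : dist x z ^ (-s) ≤ (D / r + 1) ^ s * dist x₁ z ^ (-s) := by
      calc dist x z ^ (-s) = (D / r + 1) ^ s * ((D / r + 1) * dist x z) ^ (-s) := by
            rw [Real.mul_rpow hq.le hxz0.le, ← mul_assoc, ← Real.rpow_add hq]; simp
        _ ≤ _ := by
            gcongr ?_ * ?_
            exact Real.rpow_le_rpow_of_nonpos hd1 h1 (by linarith)
    have h3 : 0 ≤ |M| * (ball x (3 * r)).indicator (fun z => dist x z ^ (-s)) z :=
      mul_nonneg (abs_nonneg _) (indicator_nonneg (fun _ _ => by positivity) _)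
    calc u z ^ p * dist x z ^ (-s) ≤ u z ^ p * ((D / r + 1) ^ s * dist x₁ z ^ (-s)) := by gcongr
      _ ≤ _ := by linarith

/-- A solution which is unbounded near `x₀` has a positive exponent: for `p ≤ 0` the lower bound
on `u` bounds the density `u ^ p`, hence `u` itself. -/
theorem exponent_pos_of_unbounded (h : RieszSolution s p x₀ u)
    (hunb : ∀ r > 0, ∀ M : ℝ, ∃ z, z ≠ x₀ ∧ dist z x₀ < r ∧ M < u z) : 0 < p := by
  by_contra! hp
  have hs := h.s_pos
  obtain ⟨C, r, hC, hr, hlow⟩ := h.exists_lower_bound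
  obtain ⟨M', hM'⟩ := h.bounded_of_density_bounded (a := x₀) hr
    (M := (C * (2 * r + r) ^ (-s)) ^ p) (fun z hz hz0 => by
      refine Real.rpow_le_rpow_of_nonpos (by positivity) ((?_ : _ ≤ _).trans (hlow z hz0)) hp
      gcongr ?_ * ?_
      refine Real.rpow_le_rpow_of_nonpos (by positivity) ?_ (by linarith)
      have : dist z x₀ < 2 * r := hz
      linarith)
  obtain ⟨z, hz0, hzr, hzM⟩ := hunb r hr M'
  exact absurd (hM' z hzr hz0) (not_le.2 hzM)

theorem continuousAt_of_bounded (h : RieszSolution s p x₀ u) (hp : 0 < p) {x : E} (hx : x ≠ x₀)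
    {M : ℝ} (hM : ∀ᶠ z in 𝓝 x, u z ≤ M) : ContinuousAt u x := by
  obtain ⟨r, hr, hr'⟩ := Metric.eventually_nhds_iff_ball.1 (hM.and (isOpen_ne.mem_nhds hx))
  refine (continuousAt_riesz_potential h.s_pos h.s_lt hr h.ae_density_nonneg
    (M := M ^ p) (f := fun z => u z ^ p) ?_ fun y hy => h.integrable y (hr' y hy).2).congr ?_
  · refine Eventually.of_forall fun z hz => ?_
    exact Real.rpow_le_rpow (h.pos z (hr' z hz).2).le (hr' z hz).1 hp.le
  · filter_upwards [isOpen_ne.mem_nhds hx] with y hy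
    exact (h.eq y hy).symm

end RieszSolution

/-- A Riesz solution in the subcritical or critical range `p s ≤ 2 dim E - s`, continuous off `x₀`
and unbounded near `x₀`. -/
structure SingularRieszSolution (s p : ℝ) (x₀ : E) (u : E → ℝ) : Prop
    extends RieszSolution s p x₀ u where
  p_pos : 0 < p
  p_le : p * s ≤ 2 * finrank ℝ E - s
  continuousOn : ContinuousOn u {x₀}ᶜ
  unbounded : ∀ r > 0, ∀ M : ℝ, ∃ z, z ≠ x₀ ∧ dist z x₀ < r ∧ M < u z

end Solution

theorem IsPositiveSolutionOff.singularRieszSolution {n : ℕ} {α p : ℝ} (hα : 0 < α) (hαn : α < n)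
    (hp : p ≤ ((n : ℝ) + α) / ((n : ℝ) - α)) {x₀ : EuclideanSpace ℝ (Fin n)}
    {u : EuclideanSpace ℝ (Fin n) → ℝ} (hu : IsPositiveSolutionOff n α p x₀ u)
    (hsing : ∀ z, IsSingularPoint u z ↔ z = x₀) :
    SingularRieszSolution ((n : ℝ) - α) p x₀ u := by
  have hker : ∀ x z : EuclideanSpace ℝ (Fin n),
      u z ^ p / ‖x - z‖ ^ ((n : ℝ) - α) = u z ^ p * dist x z ^ (-((n : ℝ) - α)) := fun x z => by
    rw [Real.rpow_neg dist_nonneg, dist_eq_norm, div_eq_mul_inv]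
  have hR : RieszSolution ((n : ℝ) - α) p x₀ u :=
    { s_pos := by linarith
      s_lt := by simp [hα]
      pos := hu.pos
      integrable := fun x hx => by simpa only [hker] using hu.integrable x hx
      eq := fun x hx => by simpa only [hker] using hu.eq x hx }
  have hunb : ∀ r > 0, ∀ M : ℝ, ∃ z, z ≠ x₀ ∧ dist z x₀ < r ∧ M < u z := by
    intro r hr M
    by_contra! hcon
    refine (hsing x₀).2 rfl ⟨M, ?_⟩
    filter_upwards [self_mem_nhdsWithin, mem_nhdsWithin_of_mem_nhds (ball_mem_nhds x₀ hr)]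
      with z hz hzr
    rw [abs_of_pos (hu.pos z hz)]
    exact hcon z hz hzr
  have hp0 := hR.exponent_pos_of_unbounded hunb
  refine { hR with
    p_pos := hp0
    p_le := ?_
    continuousOn := fun x hx => ?_
    unbounded := hunb }
  · rw [le_div_iff₀ (by linarith)] at hp
    rw [finrank_euclideanSpace_fin]
    linarith
  · have hx' : x ≠ x₀ := hx
    obtain ⟨M, hM⟩ := not_not.1 (mt (hsing x).1 hx')
    refine (hR.continuousAt_of_bounded hp0 hx' (M := max M (u x)) ?_).continuousWithinAt
    rw [eventually_nhdsWithin_iff] at hM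
    filter_upwards [hM] with z hz
    by_cases hzx : z = x
    · rw [hzx]; exact le_max_right _ _
    · exact (le_abs_self _).trans ((hz hzx).trans (le_max_left _ _))

/-! ### Inversions, the Kelvin transform and the folded equation -/

section Inversion

variable {E : Type*} [NormedAddCommGroup E] [InnerProductSpace ℝ E]

theorem abs_det_smul_reflection [FiniteDimensional ℝ E] (t : ℝ) (K : Submodule ℝ E) :
    |(t ^ 2 • (K.reflection : E →L[ℝ] E)).det| = t ^ (2 * finrank ℝ E) := by
  have h1 : (t ^ 2 • (K.reflection : E →L[ℝ] E)).det
      = (t ^ 2) ^ finrank ℝ E * LinearMap.det K.reflection.toLinearMap := by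
    rw [ContinuousLinearMap.det, ContinuousLinearMap.toLinearMap_smul, LinearMap.det_smul]
    rfl
  rw [h1, Submodule.det_reflection, abs_mul,
    abs_of_nonneg (by positivity : 0 ≤ (t ^ 2) ^ finrank ℝ E), abs_neg_one_pow, mul_one, pow_mul]

theorem image_inversion_exterior {c : E} {R : ℝ} (hR : 0 < R) :
    inversion c R '' {z | R < dist z c} = ball c R \ {c} := by
  ext w
  constructor
  · rintro ⟨z, hz, rfl⟩
    have hz' : R < dist z c := hz
    have hzc : 0 < dist z c := hR.trans hz'
    refine ⟨?_, ?_⟩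
    · rw [mem_ball, dist_inversion_center, div_lt_iff₀ hzc]
      nlinarith
    · rw [mem_singleton_iff, inversion_eq_center hR.ne']
      exact dist_pos.1 hzc
  · rintro ⟨hw, hwc⟩
    have hwc' : 0 < dist w c := dist_pos.2 hwc
    refine ⟨inversion c R w, ?_, inversion_inversion c hR.ne' w⟩
    rw [mem_ball] at hw
    rw [Set.mem_ofPred_eq, dist_inversion_center, lt_div_iff₀ hwc']
    nlinarith

theorem dist_inversion_right {c x z : E} {R : ℝ} (hR : 0 < R) (hx : x ≠ c) (hz : z ≠ c) :
    dist x (inversion c R z) = dist x c / dist z c * dist (inversion c R x) z := by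
  have hx' : 0 < dist x c := dist_pos.2 hx
  have hz' : 0 < dist z c := dist_pos.2 hz
  have h := dist_inversion_inversion (x := inversion c R x) (y := z) (c := c)
    (by rwa [Ne, inversion_eq_center hR.ne']) hz R
  rw [inversion_inversion c hR.ne', dist_inversion_center] at h
  rw [h]
  field_simp

/-- Relation between the distances from a point `z` to `y` and to its inverse; the excess is
positive when `y` and `z` lie on the same side of the sphere. -/
theorem sq_dist_inversion {c y z : E} {R : ℝ} (hR : 0 < R) (hy : y ≠ c) :
    (dist y c / R * dist (inversion c R y) z) ^ 2 = dist y z ^ 2 +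
      (dist y c ^ 2 - R ^ 2) * (dist z c ^ 2 - R ^ 2) / R ^ 2 := by
  have hy' : 0 < dist y c := dist_pos.2 hy
  have h1 : dist (inversion c R y) z ^ 2 = (R / dist y c) ^ 4 * dist y c ^ 2
      - 2 * (R / dist y c) ^ 2 * inner ℝ (y - c) (z - c) + dist z c ^ 2 := by
    have : inversion c R y - z = (R / dist y c) ^ 2 • (y - c) - (z - c) := by
      simp only [inversion, vsub_eq_sub, vadd_eq_add]; abel
    rw [dist_eq_norm (inversion c R y), this, norm_sub_sq_real, norm_smul, inner_smul_left,
      ← dist_eq_norm, ← dist_eq_norm, Real.norm_of_nonneg (by positivity)]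
    simp only [conj_trivial]
    ring
  have h2 : dist y z ^ 2 = dist y c ^ 2 - 2 * inner ℝ (y - c) (z - c) + dist z c ^ 2 := by
    have : y - z = (y - c) - (z - c) := by abel
    rw [dist_eq_norm y z, this, norm_sub_sq_real, ← dist_eq_norm, ← dist_eq_norm]
  rw [mul_pow, h1, h2]
  field_simp
  ring

/-- The Kelvin transform of `u` with weight `s` with respect to the sphere of centre `c` and
radius `R`. -/
noncomputable def kelvin (s : ℝ) (c : E) (R : ℝ) (u : E → ℝ) (y : E) : ℝ :=
  (R / dist y c) ^ s * u (inversion c R y)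

/-- The Green-type kernel of the exterior of a ball: the difference of the Riesz kernels with pole
at `y` and at its inverse. -/
noncomputable def exteriorKernel (s : ℝ) (c : E) (R : ℝ) (y z : E) : ℝ :=
  dist y z ^ (-s) - (R / dist y c) ^ s * dist (inversion c R y) z ^ (-s)

/-- The density `u ^ p` minus the density which the inversion induces from it. -/
noncomputable def densityGap (s p : ℝ) (c : E) (R : ℝ) (u : E → ℝ) (z : E) : ℝ :=
  u z ^ p - (R / dist z c) ^ (2 * (finrank ℝ E : ℝ) - s - p * s) * kelvin s c R u z ^ p

theorem exteriorKernel_eq {s : ℝ} {c y : E} {R : ℝ} (hR : 0 < R) (hy : y ≠ c) (z : E) :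
    exteriorKernel s c R y z =
      dist y z ^ (-s) - (dist y c / R * dist (inversion c R y) z) ^ (-s) := by
  have hy' : 0 < dist y c := dist_pos.2 hy
  rw [exteriorKernel, Real.mul_rpow (by positivity) dist_nonneg,
    Real.rpow_neg (by positivity : 0 ≤ dist y c / R), ← Real.inv_rpow (by positivity), inv_div]

theorem exteriorKernel_le {s : ℝ} {c y z : E} {R : ℝ} (hR : 0 < R) :
    exteriorKernel s c R y z ≤ dist y z ^ (-s) := by
  have : 0 ≤ (R / dist y c) ^ s * dist (inversion c R y) z ^ (-s) := by positivity
  rw [exteriorKernel]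
  linarith

theorem exteriorKernel_nonneg {s : ℝ} (hs : 0 < s) {c y z : E} {R : ℝ} (hR : 0 < R)
    (hy : R < dist y c) (hz : R < dist z c) (hzy : z ≠ y) : 0 ≤ exteriorKernel s c R y z := by
  have hyc : y ≠ c := dist_pos.1 (hR.trans hy)
  rw [exteriorKernel_eq hR hyc, sub_nonneg]
  refine Real.rpow_le_rpow_of_nonpos (dist_pos.2 hzy.symm) ?_ (by linarith)
  refine (sq_le_sq₀ (by positivity) (by positivity)).1 ?_
  rw [sq_dist_inversion hR hyc]
  have h1 : 0 ≤ dist y c ^ 2 - R ^ 2 := by nlinarith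
  have h2 : 0 ≤ dist z c ^ 2 - R ^ 2 := by nlinarith
  have : 0 ≤ (dist y c ^ 2 - R ^ 2) * (dist z c ^ 2 - R ^ 2) / R ^ 2 := by positivity
  linarith

/-- Away from the sphere the exterior kernel decays no faster than `|y - c|⁻ˢ`, uniformly for `z` in
an annulus. -/
theorem exists_exteriorKernel_lower_bound {s : ℝ} (hs : 0 < s) (c : E) {R R' A : ℝ} (hR : 0 < R)
    (hR' : R < R') (hA : 0 < A) : ∃ κ : ℝ, 0 < κ ∧ ∀ y z : E, R' ≤ dist y c → R' ≤ dist z c →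
      dist z c ≤ A → z ≠ y → κ * dist y c ^ (-s) ≤ exteriorKernel s c R y z := by
  have hR'0 : 0 < R' := hR.trans hR'
  set B : ℝ := 1 + A / R' with hB
  have hB0 : 0 < B := by positivity
  have hq : 0 < 1 - R ^ 2 / R' ^ 2 := by
    rw [sub_pos, div_lt_one (by positivity)]; gcongr
  have hq' : 0 < R' ^ 2 - R ^ 2 := by rw [sub_pos]; gcongr
  set θ : ℝ := (1 - R ^ 2 / R' ^ 2) * (R' ^ 2 - R ^ 2) / R ^ 2 / B ^ 2 with hθ
  have hθ0 : 0 < θ := by positivity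
  set σ : ℝ := √(1 + θ) with hσ
  have hσ1 : 1 < σ := by
    rw [hσ, Real.lt_sqrt zero_le_one]; linarith
  have hσ0 : 0 < σ := one_pos.trans hσ1
  have hσs : 0 < 1 - σ ^ (-s) := by
    rw [sub_pos]; exact Real.rpow_lt_one_of_one_lt_of_neg hσ1 (by linarith)
  refine ⟨B ^ (-s) * (1 - σ ^ (-s)), by positivity, fun y z hy hz hzA hzy => ?_⟩
  have hy0 : 0 < dist y c := hR'0.trans_le hy
  have hyc : y ≠ c := dist_pos.1 hy0
  have ha : 0 < dist y z := dist_pos.2 hzy.symm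
  have haB : dist y z ≤ B * dist y c := by
    have h1 : A ≤ A / R' * dist y c := by
      rw [div_mul_eq_mul_div, le_div_iff₀ hR'0]; gcongr
    linarith [dist_triangle y c z, dist_comm c z]
  have hb : σ * dist y z ≤ dist y c / R * dist (inversion c R y) z := by
    refine (sq_le_sq₀ (by positivity) (by positivity)).1 ?_
    rw [sq_dist_inversion hR hyc, mul_pow, hσ, Real.sq_sqrt (by linarith)]
    have h1 : dist y z ^ 2 ≤ B ^ 2 * dist y c ^ 2 := by
      rw [← mul_pow]; gcongr
    have h2 : θ * dist y z ^ 2 ≤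
        (1 - R ^ 2 / R' ^ 2) * (R' ^ 2 - R ^ 2) / R ^ 2 * dist y c ^ 2 := by
      calc θ * dist y z ^ 2 ≤ θ * (B ^ 2 * dist y c ^ 2) := by gcongr
        _ = _ := by rw [hθ]; field_simp
    have h3 : (1 - R ^ 2 / R' ^ 2) * dist y c ^ 2 ≤ dist y c ^ 2 - R ^ 2 := by
      have : R ^ 2 ≤ R ^ 2 / R' ^ 2 * dist y c ^ 2 := by
        rw [div_mul_eq_mul_div, le_div_iff₀ (by positivity)]; gcongr
      linarith
    have h4 : (1 - R ^ 2 / R' ^ 2) * (R' ^ 2 - R ^ 2) / R ^ 2 * dist y c ^ 2 ≤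
        (dist y c ^ 2 - R ^ 2) * (dist z c ^ 2 - R ^ 2) / R ^ 2 := by
      rw [div_mul_eq_mul_div]
      refine div_le_div_of_nonneg_right ?_ (by positivity)
      calc (1 - R ^ 2 / R' ^ 2) * (R' ^ 2 - R ^ 2) * dist y c ^ 2
          = ((1 - R ^ 2 / R' ^ 2) * dist y c ^ 2) * (R' ^ 2 - R ^ 2) := by ring
        _ ≤ (dist y c ^ 2 - R ^ 2) * (dist z c ^ 2 - R ^ 2) := by
          have : 0 ≤ (1 - R ^ 2 / R' ^ 2) * dist y c ^ 2 := by positivity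
          gcongr
          linarith
    linarith
  rw [exteriorKernel_eq hR hyc]
  have h1 : (dist y c / R * dist (inversion c R y) z) ^ (-s) ≤ σ ^ (-s) * dist y z ^ (-s) := by
    rw [← Real.mul_rpow hσ0.le ha.le]
    exact Real.rpow_le_rpow_of_nonpos (by positivity) hb (by linarith)
  have h2 : B ^ (-s) * dist y c ^ (-s) ≤ dist y z ^ (-s) := by
    rw [← Real.mul_rpow hB0.le hy0.le]
    exact Real.rpow_le_rpow_of_nonpos ha haB (by linarith)
  calc B ^ (-s) * (1 - σ ^ (-s)) * dist y c ^ (-s)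
      = (B ^ (-s) * dist y c ^ (-s)) * (1 - σ ^ (-s)) := by ring
    _ ≤ dist y z ^ (-s) * (1 - σ ^ (-s)) := by gcongr
    _ ≤ _ := by linarith

theorem inversion_ne_of_exterior {c x₀ z : E} {R : ℝ} (hR : 0 < R) (hx₀ : R < dist x₀ c)
    (hz : R < dist z c) : inversion c R z ≠ x₀ := by
  rintro rfl
  have : inversion c R z ∈ ball c R \ {c} := by
    rw [← image_inversion_exterior hR]; exact ⟨z, hz, rfl⟩
  exact lt_asymm hx₀ this.1

variable [FiniteDimensional ℝ E] [MeasurableSpace E] [BorelSpace E]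

theorem measurableSet_exterior {X : Type*} [PseudoMetricSpace X] [MeasurableSpace X]
    [OpensMeasurableSpace X] (c : X) (R : ℝ) : MeasurableSet {z | R < dist z c} :=
  (isOpen_lt continuous_const (by fun_prop)).measurableSet

/-- Folding an integral over the whole space onto the exterior of a ball by the inversion. -/
theorem integral_eq_setIntegral_exterior_add [Nontrivial E] {g : E → ℝ} (hg : Integrable g)
    (c : E) {R : ℝ} (hR : 0 < R) :
    IntegrableOn (fun z => (R / dist z c) ^ (2 * finrank ℝ E) * g (inversion c R z))
      {z | R < dist z c} ∧
    ∫ z, g z = (∫ z in {z | R < dist z c}, g z) +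
      ∫ z in {z | R < dist z c}, (R / dist z c) ^ (2 * finrank ℝ E) * g (inversion c R z) := by
  have hS := measurableSet_exterior c R
  have hder : ∀ z ∈ {z | R < dist z c}, HasFDerivWithinAt (inversion c R)
      ((R / dist z c) ^ 2 • ((ℝ ∙ (z - c))ᗮ.reflection : E →L[ℝ] E)) {z | R < dist z c} z :=
    fun z hz => (hasFDerivAt_inversion (dist_pos.1 (hR.trans hz))).hasFDerivWithinAt
  have hinj : InjOn (inversion c R) {z | R < dist z c} := (inversion_injective c hR.ne').injOn
  have hae : ({z | R < dist z c}ᶜ : Set E) =ᵐ[volume] (ball c R \ {c} : Set E) := by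
    have h1 : ∀ᵐ z : E, z ≠ c := compl_mem_ae_iff.2 (measure_singleton c)
    have h2 : ∀ᵐ z : E, z ∉ sphere c R := compl_mem_ae_iff.2 (Measure.addHaar_sphere volume c R)
    filter_upwards [h1, h2] with z hz hz2
    have hz2' : dist z c ≠ R := hz2
    refine propext ?_
    change ¬ (R < dist z c) ↔ dist z c < R ∧ ¬ z = c
    rw [not_lt]
    exact ⟨fun h => ⟨lt_of_le_of_ne h hz2', hz⟩, fun h => h.1.le⟩
  constructor
  · have := (integrableOn_image_iff_integrableOn_abs_det_fderiv_smul volume hS hder hinj g).1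
      hg.integrableOn
    simpa only [abs_det_smul_reflection, smul_eq_mul] using this
  · have := integral_image_eq_integral_abs_det_fderiv_smul volume hS hder hinj g
    simp only [abs_det_smul_reflection, smul_eq_mul] at this
    rw [← this, image_inversion_exterior hR, ← integral_add_compl hS hg,
      setIntegral_congr_set hae]

namespace RieszSolution

variable {s p : ℝ} {x₀ : E} {u : E → ℝ}

/-- The conformal covariance of the integrand of the equation under an inversion. -/
theorem jacobian_mul_density_inversion (h : RieszSolution s p x₀ u) {c x z : E} {R : ℝ}
    (hR : 0 < R) (hx₀ : R < dist x₀ c) (hx : x ≠ c) (hz : R < dist z c) :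
    (R / dist z c) ^ (2 * finrank ℝ E) *
        (u (inversion c R z) ^ p * dist x (inversion c R z) ^ (-s)) =
      (R / dist z c) ^ (2 * (finrank ℝ E : ℝ) - s - p * s) * kelvin s c R u z ^ p *
        ((R / dist x c) ^ s * dist (inversion c R x) z ^ (-s)) := by
  have hz0 : 0 < dist z c := hR.trans hz
  have hx0 : 0 < dist x c := dist_pos.2 hx
  have hu : 0 < u (inversion c R z) := h.pos _ (inversion_ne_of_exterior hR hx₀ hz)
  have hq : 0 < R / dist z c := by positivity
  have hq' : 0 < R / dist x c := by positivity
  have h1 : dist x (inversion c R z) ^ (-s) =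
      (R / dist z c) ^ (-s) * (R / dist x c) ^ s * dist (inversion c R x) z ^ (-s) := by
    rw [dist_inversion_right hR hx (dist_pos.1 hz0), Real.mul_rpow (by positivity) dist_nonneg]
    congr 1
    have : dist x c / dist z c = R / dist z c * (R / dist x c)⁻¹ := by field_simp
    rw [this, Real.mul_rpow hq.le (by positivity), Real.inv_rpow hq'.le, Real.rpow_neg hq'.le,
      inv_inv]
  have h2 : kelvin s c R u z ^ p = (R / dist z c) ^ (p * s) * u (inversion c R z) ^ p := by
    rw [kelvin, Real.mul_rpow (by positivity) hu.le, ← Real.rpow_mul hq.le, mul_comm s p]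
  have h3 : (R / dist z c) ^ (2 * (finrank ℝ E : ℝ) - s - p * s) * (R / dist z c) ^ (p * s) =
      (R / dist z c) ^ (2 * finrank ℝ E) * (R / dist z c) ^ (-s) := by
    rw [← Real.rpow_natCast (R / dist z c), ← Real.rpow_add hq, ← Real.rpow_add hq]
    congr 1
    push_cast
    ring
  rw [h1, h2]
  linear_combination (- u (inversion c R z) ^ p *
    ((R / dist x c) ^ s * dist (inversion c R x) z ^ (-s))) * h3

/-- The equation satisfied by the difference of a solution and its Kelvin transform in the
exterior of a ball. -/
theorem sub_kelvin_eq (h : RieszSolution s p x₀ u) {c y : E} {R : ℝ} (hR : 0 < R)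
    (hx₀ : R < dist x₀ c) (hy : R < dist y c) (hyx : y ≠ x₀) :
    IntegrableOn (fun z => exteriorKernel s c R y z * densityGap s p c R u z) {z | R < dist z c} ∧
    u y - kelvin s c R u y =
      ∫ z in {z | R < dist z c}, exteriorKernel s c R y z * densityGap s p c R u z := by
  have := h.nontrivial
  have hy0 : 0 < dist y c := hR.trans hy
  have hyc : y ≠ c := dist_pos.1 hy0
  have hyc' : inversion c R y ≠ c := by rwa [Ne, inversion_eq_center hR.ne']
  have hyx' := inversion_ne_of_exterior hR hx₀ hy
  set S : Set E := {z | R < dist z c} with hS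
  have hSm : MeasurableSet S := measurableSet_exterior c R
  set v : E → ℝ := fun z =>
    (R / dist z c) ^ (2 * (finrank ℝ E : ℝ) - s - p * s) * kelvin s c R u z ^ p with hv
  have hfold : ∀ x, x ≠ c → x ≠ x₀ →
      IntegrableOn (fun z => v z * ((R / dist x c) ^ s * dist (inversion c R x) z ^ (-s))) S ∧
      u x = (∫ z in S, u z ^ p * dist x z ^ (-s)) +
        ∫ z in S, v z * ((R / dist x c) ^ s * dist (inversion c R x) z ^ (-s)) := by
    intro x hxc hxx
    obtain ⟨h1, h2⟩ := integral_eq_setIntegral_exterior_add (h.integrable x hxx) c hR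
    have hcongr : EqOn (fun z => (R / dist z c) ^ (2 * finrank ℝ E) *
        (u (inversion c R z) ^ p * dist x (inversion c R z) ^ (-s)))
        (fun z => v z * ((R / dist x c) ^ s * dist (inversion c R x) z ^ (-s))) S :=
      fun z hz => h.jacobian_mul_density_inversion hR hx₀ hxc hz
    refine ⟨h1.congr_fun hcongr hSm, ?_⟩
    rw [h.eq x hxx, h2, setIntegral_congr_fun hSm hcongr]
  obtain ⟨hi1, he1⟩ := hfold y hyc hyx
  obtain ⟨hi2, he2⟩ := hfold _ hyc' hyx'
  have hj1 : IntegrableOn (fun z => u z ^ p * dist y z ^ (-s)) S :=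
    (h.integrable y hyx).integrableOn
  have hj2 : IntegrableOn (fun z => u z ^ p * dist (inversion c R y) z ^ (-s)) S :=
    (h.integrable _ hyx').integrableOn
  have hone : (R / dist y c) ^ s * (R / dist (inversion c R y) c) ^ s = 1 := by
    rw [← Real.mul_rpow (by positivity) (by positivity), dist_inversion_center]
    have : R / dist y c * (R / (R ^ 2 / dist y c)) = 1 := by field_simp
    rw [this, Real.one_rpow]
  have hk : ∀ z, exteriorKernel s c R y z * densityGap s p c R u z =
      (u z ^ p * dist y z ^ (-s) + v z * ((R / dist y c) ^ s * dist (inversion c R y) z ^ (-s))) -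
      (R / dist y c) ^ s * (u z ^ p * dist (inversion c R y) z ^ (-s) +
        v z * ((R / dist (inversion c R y) c) ^ s *
          dist (inversion c R (inversion c R y)) z ^ (-s))) := by
    intro z
    rw [inversion_inversion c hR.ne', exteriorKernel, densityGap]
    linear_combination (v z * dist y z ^ (-s)) * hone
  simp only [hk]
  have hI1 := hj1.fun_add hi1
  have hI2 := (hj2.fun_add hi2).const_mul ((R / dist y c) ^ s)
  refine ⟨hI1.fun_sub hI2, ?_⟩
  rw [integral_sub hI1 hI2, integral_const_mul, integral_add hj1 hi1, integral_add hj2 hi2,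
    ← he1, ← he2, kelvin]

end RieszSolution

end Inversion

/-! ### Moving the spheres -/

section MovingSpheres

theorem exists_rpow_sub_le_mul_sub {p m : ℝ} (hm : 0 < m) (M : ℝ) :
    ∃ L : ℝ, 0 < L ∧ ∀ a ∈ Icc m M, ∀ b ∈ Icc m M, a ≤ b → b ^ p - a ^ p ≤ L * (b - a) := by
  have hne : ∀ t ∈ Icc m M, t ≠ 0 := fun t ht => (hm.trans_le ht.1).ne'
  obtain ⟨L, hL⟩ := isCompact_Icc.exists_bound_of_continuousOn
    (f := fun t : ℝ => p * t ^ (p - 1)) (s := Icc m M)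
    (continuousOn_const.mul (continuousOn_id.rpow_const fun t ht => Or.inl (hne t ht)))
  refine ⟨|L| + 1, by positivity, fun a ha b hb hab => ?_⟩
  have h := Convex.norm_image_sub_le_of_norm_hasDerivWithin_le (f := fun t : ℝ => t ^ p)
    (f' := fun t => p * t ^ (p - 1)) (C := |L| + 1) (s := Icc m M)
    (fun t ht => (Real.hasDerivAt_rpow_const (Or.inl (hne t ht))).hasDerivWithinAt)
    (fun t ht => (hL t ht).trans (by linarith [le_abs_self L])) (convex_Icc m M) ha hb
  rw [Real.norm_of_nonneg (sub_nonneg.2 hab)] at h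
  exact (le_abs_self _).trans h

theorem exists_volume_annulus_le {E : Type*} [NormedAddCommGroup E] [InnerProductSpace ℝ E]
    [FiniteDimensional ℝ E] [MeasurableSpace E] [BorelSpace E] (c : E) (R : ℝ) {δ : ℝ}
    (hδ : 0 < δ) :
    ∃ η > 0, volume (ball c (R + η) \ closedBall c R) ≤ ENNReal.ofReal δ := by
  have h := tendsto_measure_iInter_atTop (μ := (volume : Measure E))
    (s := fun k : ℕ => ball c (R + 1 / ((k : ℝ) + 1)) \ closedBall c R)
    (fun k => (measurableSet_ball.diff measurableSet_closedBall).nullMeasurableSet)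
    (fun i j hij => sdiff_subset_sdiff_left (ball_subset_ball (by gcongr)))
    ⟨0, ((measure_mono sdiff_subset).trans_lt measure_ball_lt_top).ne⟩
  have hI : (⋂ k : ℕ, ball c (R + 1 / ((k : ℝ) + 1)) \ closedBall c R) = ∅ := by
    refine eq_empty_of_forall_notMem fun z hz => ?_
    rw [mem_iInter] at hz
    have h0 : R < dist z c := not_le.1 (hz 0).2
    obtain ⟨k, hk⟩ := exists_nat_one_div_lt (sub_pos.2 h0)
    have : dist z c < R + 1 / ((k : ℝ) + 1) := (hz k).1
    linarith
  rw [hI, measure_empty] at h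
  obtain ⟨k, hk⟩ := (h.eventually_lt_const (ENNReal.ofReal_pos.2 hδ)).exists
  exact ⟨1 / ((k : ℝ) + 1), by positivity, hk.le⟩

variable {E : Type*} [NormedAddCommGroup E] [InnerProductSpace ℝ E]

/-- The Kelvin transform of `u` with respect to the sphere of centre `c` and radius `R` is at most
`u` outside this sphere, the point `x₀` being disregarded. -/
def KelvinLE (s : ℝ) (x₀ : E) (u : E → ℝ) (c : E) (R : ℝ) : Prop :=
  ∀ y, R < dist y c → y ≠ x₀ → kelvin s c R u y ≤ u y

theorem inversion_mem_closedBall {c y : E} {R : ℝ} (hR : 0 < R) (hy : R < dist y c) :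
    inversion c R y ∈ closedBall c R := by
  have : inversion c R y ∈ ball c R \ {c} := by
    rw [← image_inversion_exterior hR]; exact ⟨y, hy, rfl⟩
  exact ball_subset_closedBall this.1

variable [FiniteDimensional ℝ E] [MeasurableSpace E] [BorelSpace E]

namespace SingularRieszSolution

variable {s p : ℝ} {x₀ : E} {u : E → ℝ}

theorem exists_bounds (h : SingularRieszSolution s p x₀ u) {c : E} {R : ℝ} (hR : 0 < R)
    (hx₀ : R < dist x₀ c) : ∃ m M : ℝ, 0 < m ∧ ∀ z ∈ closedBall c R, m ≤ u z ∧ u z ≤ M := by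
  have hne : ∀ z ∈ closedBall c R, z ≠ x₀ := by
    rintro z hz rfl; exact absurd hx₀ (not_lt.2 hz)
  have hcont : ContinuousOn u (closedBall c R) := h.continuousOn.mono hne
  have hK := isCompact_closedBall c R
  have hnon : (closedBall c R).Nonempty := nonempty_closedBall.2 hR.le
  obtain ⟨a, ha, hmin⟩ := hK.exists_isMinOn hnon hcont
  obtain ⟨b, hb, hmax⟩ := hK.exists_isMaxOn hnon hcont
  exact ⟨u a, u b, h.pos a (hne a ha), fun z hz => ⟨hmin hz, hmax hz⟩⟩

theorem kelvin_pos (h : SingularRieszSolution s p x₀ u) {c z : E} {R : ℝ} (hR : 0 < R)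
    (hx₀ : R < dist x₀ c) (hz : R < dist z c) : 0 < kelvin s c R u z := by
  have hz0 := hR.trans hz
  exact mul_pos (by positivity) (h.pos _ (inversion_ne_of_exterior hR hx₀ hz))

theorem kelvin_le (h : SingularRieszSolution s p x₀ u) {c z : E} {R M : ℝ} (hR : 0 < R)
    (hx₀ : R < dist x₀ c) (hz : R < dist z c) (hM : ∀ w ∈ closedBall c R, u w ≤ M) :
    kelvin s c R u z ≤ M := by
  have hz0 := hR.trans hz
  have h1 : (R / dist z c) ^ s ≤ 1 :=
    Real.rpow_le_one (by positivity) ((div_le_one hz0).2 hz.le) h.s_pos.le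
  have h2 := h.pos _ (inversion_ne_of_exterior hR hx₀ hz)
  calc kelvin s c R u z ≤ 1 * u (inversion c R z) := by rw [kelvin]; gcongr
    _ ≤ M := by rw [one_mul]; exact hM _ (inversion_mem_closedBall hR hz)

/-- Subcriticality enters here: the conformal weight is at most `1` outside the sphere. -/
theorem rpow_sub_rpow_le_densityGap (h : SingularRieszSolution s p x₀ u) {c z : E} {R : ℝ}
    (hR : 0 < R) (hx₀ : R < dist x₀ c) (hz : R < dist z c) :
    u z ^ p - kelvin s c R u z ^ p ≤ densityGap s p c R u z := by
  have hz0 := hR.trans hz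
  have h1 : (R / dist z c) ^ (2 * (finrank ℝ E : ℝ) - s - p * s) ≤ 1 :=
    Real.rpow_le_one (by positivity) ((div_le_one hz0).2 hz.le) (by linarith [h.p_le])
  have h2 : 0 ≤ kelvin s c R u z ^ p := Real.rpow_nonneg (h.kelvin_pos hR hx₀ hz).le p
  have := mul_le_mul_of_nonneg_right h1 h2
  rw [densityGap]
  linarith

theorem densityGap_nonneg (h : SingularRieszSolution s p x₀ u) {c z : E} {R : ℝ}
    (hR : 0 < R) (hx₀ : R < dist x₀ c) (hz : R < dist z c) (hle : kelvin s c R u z ≤ u z) :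
    0 ≤ densityGap s p c R u z := by
  have := Real.rpow_le_rpow (h.kelvin_pos hR hx₀ hz).le hle h.p_pos.le
  linarith [h.rpow_sub_rpow_le_densityGap hR hx₀ hz]

/-- Narrow region principle: if the Kelvin transform is at most `u` outside an annulus of small
volume around the sphere, then it is so throughout the exterior. The positive part of the
difference is halved by the integral equation, hence vanishes. -/
theorem exists_narrow_region (h : SingularRieszSolution s p x₀ u) {c : E} {R₀ : ℝ} (hR₀ : 0 < R₀)
    (hx₀ : R₀ < dist x₀ c) : ∃ δ > 0, ∀ R R₁ : ℝ, 0 < R → R < R₁ → R₁ ≤ R₀ →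
      volume (ball c R₁ \ closedBall c R) ≤ ENNReal.ofReal δ →
      (∀ y, R₁ ≤ dist y c → y ≠ x₀ → kelvin s c R u y ≤ u y) → KelvinLE s x₀ u c R := by
  obtain ⟨m, M, hm, hmM⟩ := h.exists_bounds hR₀ hx₀
  obtain ⟨L, hL, hLip⟩ := exists_rpow_sub_le_mul_sub (p := p) hm M
  obtain ⟨δ, hδ, hker⟩ := exists_setIntegral_dist_rpow_neg_le (E := E) h.s_pos h.s_lt
    (show 0 < 1 / (2 * L) by positivity)
  refine ⟨δ, hδ, fun R R₁ hR hRR₁ hR₁ hvol hout => ?_⟩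
  have hx : R < dist x₀ c := by linarith
  set A : Set E := ball c R₁ \ closedBall c R with hA
  have hAm : MeasurableSet A := measurableSet_ball.diff measurableSet_closedBall
  have hM0 : 0 ≤ M := by
    have := hmM c (mem_closedBall_self hR₀.le); linarith
  have hMR : ∀ w ∈ closedBall c R, u w ≤ M := fun w hw =>
    (hmM w (closedBall_subset_closedBall (by linarith) hw)).2
  have hmem : ∀ z, R < dist z c → dist z c < R₁ → z ∈ closedBall c R₀ := fun z _ hz =>
    mem_closedBall.2 (hz.le.trans hR₁)
  have key : ∀ k : ℕ, ∀ y, R < dist y c → dist y c < R₁ → kelvin s c R u y - u y ≤ M / 2 ^ k := by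
    intro k
    induction k with
    | zero =>
      intro y hy hy1
      have h1 := h.kelvin_le hR hx hy hMR
      have h2 := (hmM y (hmem y hy hy1)).1
      simp only [pow_zero, div_one]
      linarith
    | succ k ih =>
      intro y hy hy1
      set S : ℝ := M / 2 ^ k with hS
      have hS0 : 0 ≤ S := by positivity
      have hyx : y ≠ x₀ := by
        rintro rfl; linarith
      obtain ⟨hint, heq⟩ := h.toRieszSolution.sub_kelvin_eq hR hx hy hyx
      obtain ⟨hki, hkl⟩ := hker A hAm hvol y
      have hki' : Integrable (A.indicator fun z => dist y z ^ (-s)) :=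
        (integrable_indicator_iff hAm).2 hki
      -- the integrand of the equation is negative only where `u < u_R`, hence only in the annulus,
      -- and there the Lipschitz bound and the induction hypothesis apply
      have hpt : ∀ᵐ z, z ∈ {z | R < dist z c} →
          -(L * S) * A.indicator (fun z => dist y z ^ (-s)) z ≤
            exteriorKernel s c R y z * densityGap s p c R u z := by
        filter_upwards [h.ae_ne y, h.ae_ne x₀] with z hzy hzx hz
        have hz' : R < dist z c := hz
        have hK0 := exteriorKernel_nonneg h.s_pos hR hy hz' hzy
        have hI0 : 0 ≤ A.indicator (fun z => dist y z ^ (-s)) z :=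
          indicator_nonneg (fun _ _ => by positivity) _
        rcases le_or_gt 0 (densityGap s p c R u z) with hg | hg
        · have h1 := mul_nonneg hK0 hg
          have h2 := mul_nonneg (mul_nonneg hL.le hS0) hI0
          linarith
        · have hlt : u z < kelvin s c R u z := by
            by_contra! hle
            exact absurd (h.densityGap_nonneg hR hx hz' hle) (not_le.2 hg)
          have hz1 : dist z c < R₁ := by
            by_contra! hle
            exact absurd (hout z hle hzx) (not_le.2 hlt)
          have hzA : z ∈ A := ⟨hz1, fun hc => absurd hz' (not_lt.2 hc)⟩
          rw [indicator_of_mem hzA]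
          have hb := hmM z (hmem z hz' hz1)
          have hkM := h.kelvin_le hR hx hz' hMR
          have h1 := hLip (u z) hb (kelvin s c R u z) ⟨hb.1.trans hlt.le, hkM⟩ hlt.le
          have h2 := h.rpow_sub_rpow_le_densityGap hR hx hz'
          have h3 : L * (kelvin s c R u z - u z) ≤ L * S := by
            have := ih z hz' hz1
            gcongr
          have h4 : -(L * S) ≤ densityGap s p c R u z := by linarith
          have h5 : exteriorKernel s c R y z * -(L * S) ≤
              exteriorKernel s c R y z * densityGap s p c R u z := by gcongr
          have h6 : exteriorKernel s c R y z * (L * S) ≤ dist y z ^ (-s) * (L * S) := by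
            gcongr
            exact exteriorKernel_le hR
          linarith
      have hmono := setIntegral_mono_on_ae ((hki'.const_mul (-(L * S))).integrableOn) hint
        (measurableSet_exterior c R) hpt
      rw [← heq, integral_const_mul] at hmono
      have hle : ∫ z in {z | R < dist z c}, A.indicator (fun z => dist y z ^ (-s)) z ≤
          1 / (2 * L) := by
        refine (setIntegral_le_integral hki' (Eventually.of_forall fun z =>
          indicator_nonneg (fun _ _ => by positivity) _)).trans ?_
        rw [integral_indicator hAm]
        exact hkl
      have h7 : L * S * ∫ z in {z | R < dist z c}, A.indicator (fun z => dist y z ^ (-s)) z ≤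
          L * S * (1 / (2 * L)) := by gcongr
      have h8 : L * S * (1 / (2 * L)) = M / 2 ^ (k + 1) := by
        rw [hS]; field_simp; ring
      linarith
  intro y hy hyx
  rcases le_or_gt R₁ (dist y c) with hy1 | hy1
  · exact hout y hy1 hyx
  · have hlim : Tendsto (fun k : ℕ => M / 2 ^ k) atTop (𝓝 0) := by
      have := (tendsto_pow_atTop_nhds_zero_of_lt_one (r := (1 / 2 : ℝ)) (by norm_num)
        (by norm_num)).const_mul M
      simpa [div_eq_mul_inv] using this
    have := ge_of_tendsto' hlim fun k => key k y hy hy1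
    linarith

/-- Quantitative strict inequality away from the sphere. It comes from the part of the density near
`x₀`, where `u` is large and its Kelvin transform is bounded. -/
theorem exists_kelvin_add_le (h : SingularRieszSolution s p x₀ u) {c : E} {R R₁ : ℝ} (hR : 0 < R)
    (hx₀ : R < dist x₀ c) (hle : KelvinLE s x₀ u c R) (hR₁ : R < R₁) :
    ∃ ε > 0, ∀ y, R₁ ≤ dist y c → y ≠ x₀ →
      kelvin s c R u y + ε * dist y c ^ (-s) ≤ u y := by
  obtain ⟨m, M, hm, hmM⟩ := h.exists_bounds hR hx₀
  have hM0 : 0 ≤ M := by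
    have := hmM c (mem_closedBall_self hR.le); linarith
  set r := (dist x₀ c - R) / 2 with hr
  have hr0 : 0 < r := by linarith
  obtain ⟨z₀, hz₀, hz₀r, hz₀M⟩ := h.unbounded r hr0 (M + 1)
  have hev : ∀ᶠ z in 𝓝 z₀, z ≠ x₀ ∧ dist z x₀ < r ∧ M + 1 < u z := by
    refine Eventually.and (isOpen_ne.mem_nhds hz₀) (Eventually.and ?_ ?_)
    · exact (isOpen_lt (by fun_prop) continuous_const).mem_nhds hz₀r
    · exact (h.continuousOn.continuousAt (isOpen_ne.mem_nhds hz₀)).eventually_const_lt hz₀M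
  obtain ⟨ρ, hρ, hball⟩ := Metric.eventually_nhds_iff_ball.1 hev
  obtain ⟨κ, hκ, hker⟩ := exists_exteriorKernel_lower_bound h.s_pos c hR
    (R' := min R₁ (R + r)) (A := dist x₀ c + r) (lt_min hR₁ (by linarith)) (by positivity)
  set b := (M + 1) ^ p - M ^ p with hb
  have hb0 : 0 < b := sub_pos.2 (Real.rpow_lt_rpow hM0 (by linarith) h.p_pos)
  have hvol : 0 < volume.real (ball z₀ ρ) :=
    ENNReal.toReal_pos (measure_ball_pos volume z₀ hρ).ne' measure_ball_lt_top.ne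
  refine ⟨volume.real (ball z₀ ρ) * (κ * b), by positivity, fun y hy hyx => ?_⟩
  have hyR : R < dist y c := hR₁.trans_le hy
  obtain ⟨hint, heq⟩ := h.toRieszSolution.sub_kelvin_eq hR hx₀ hyR hyx
  have hfar : ∀ z ∈ ball z₀ ρ, R + r ≤ dist z c := fun z hz => by
    have h1 := (hball z hz).2.1
    have : dist x₀ c = R + 2 * r := by rw [hr]; ring
    linarith [dist_triangle x₀ z c, dist_comm x₀ z]
  have hsub : ball z₀ ρ ⊆ {z | R < dist z c} := fun z hz => by
    have := hfar z hz
    exact lt_of_lt_of_le (by linarith) this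
  have hnn : 0 ≤ᵐ[volume.restrict {z | R < dist z c}]
      fun z => exteriorKernel s c R y z * densityGap s p c R u z := by
    rw [EventuallyLE, ae_restrict_iff' (measurableSet_exterior c R)]
    filter_upwards [h.ae_ne y, h.ae_ne x₀] with z hzy hzx hz
    exact mul_nonneg (exteriorKernel_nonneg h.s_pos hR hyR hz hzy)
      (h.densityGap_nonneg hR hx₀ hz (hle z hz hzx))
  have h1 : ∫ z in ball z₀ ρ, κ * dist y c ^ (-s) * b ≤
      ∫ z in ball z₀ ρ, exteriorKernel s c R y z * densityGap s p c R u z := by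
    refine setIntegral_mono_on_ae (integrableOn_const measure_ball_lt_top.ne)
      (hint.mono_set hsub) measurableSet_ball ?_
    filter_upwards [h.ae_ne y] with z hzy hz
    have hzR : R < dist z c := hsub hz
    have hK := hker y z ((min_le_left _ _).trans hy) ((min_le_right _ _).trans (hfar z hz))
      (by linarith [(hball z hz).2.1, dist_triangle z x₀ c]) hzy
    have hg : b ≤ densityGap s p c R u z := by
      refine le_trans ?_ (h.rpow_sub_rpow_le_densityGap hR hx₀ hzR)
      have h2 : (M + 1) ^ p ≤ u z ^ p :=
        Real.rpow_le_rpow (by linarith) (hball z hz).2.2.le h.p_pos.le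
      have h3 : kelvin s c R u z ^ p ≤ M ^ p :=
        Real.rpow_le_rpow (h.kelvin_pos hR hx₀ hzR).le
          (h.kelvin_le hR hx₀ hzR fun w hw => (hmM w hw).2) h.p_pos.le
      linarith
    have hK0 : 0 ≤ κ * dist y c ^ (-s) := by positivity
    exact mul_le_mul hK hg hb0.le (hK0.trans hK)
  have h2 := setIntegral_mono_set hint hnn (LE.le.eventuallyLE hsub)
  rw [setIntegral_const, smul_eq_mul] at h1
  have h3 : volume.real (ball z₀ ρ) * (κ * b) * dist y c ^ (-s) =
      volume.real (ball z₀ ρ) * (κ * dist y c ^ (-s) * b) := by ring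
  linarith

/-- The start of the method. Outside a fixed small ball `u` dominates a multiple of `|y - c|⁻ˢ`, while
the Kelvin transform is at most `Rˢ |y - c|⁻ˢ` times a constant; inside, the narrow region principle
applies. -/
theorem exists_kelvinLE_of_small_radius (h : SingularRieszSolution s p x₀ u) {c : E}
    (hc : c ≠ x₀) : ∃ ε > 0, ∀ R, 0 < R → R < ε → KelvinLE s x₀ u c R := by
  have hs := h.s_pos
  have hD : 0 < dist x₀ c := dist_pos.2 hc.symm
  set R₀ := dist x₀ c / 2 with hR₀
  have hR₀0 : 0 < R₀ := half_pos hD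
  have hx₀ : R₀ < dist x₀ c := half_lt_self hD
  obtain ⟨m, M, hm, hmM⟩ := h.exists_bounds hR₀0 hx₀
  have hM0 : 0 < M := by
    have := hmM c (mem_closedBall_self hR₀0.le); linarith
  obtain ⟨δ, hδ, hnarrow⟩ := h.exists_narrow_region hR₀0 hx₀
  obtain ⟨η, hη, hvol⟩ := exists_volume_annulus_le c 0 hδ
  rw [zero_add] at hvol
  set R₁ := min R₀ η with hR₁
  have hR₁0 : 0 < R₁ := lt_min hR₀0 hη
  obtain ⟨C, r, hC, hr, hlow⟩ := h.exists_lower_bound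
  -- outside the ball of radius `R₁` the lower bound is comparable with `|y - c|⁻ˢ`
  set B := 1 + (dist x₀ c + r) / R₁ with hB
  have hB0 : 0 < B := by positivity
  have hlow' : ∀ y, R₁ ≤ dist y c → y ≠ x₀ → C * B ^ (-s) * dist y c ^ (-s) ≤ u y := by
    intro y hy hyx
    have hy0 := hR₁0.trans_le hy
    refine le_trans ?_ (hlow y hyx)
    rw [mul_assoc, ← Real.mul_rpow hB0.le hy0.le]
    gcongr ?_ * ?_
    refine Real.rpow_le_rpow_of_nonpos (by positivity) ?_ (by linarith)
    have h1 : dist x₀ c + r ≤ (dist x₀ c + r) / R₁ * dist y c := by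
      rw [div_mul_eq_mul_div, le_div_iff₀ hR₁0]; gcongr
    linarith [dist_triangle y c x₀, dist_comm c x₀]
  refine ⟨min R₁ ((C * B ^ (-s) / M) ^ s⁻¹), lt_min hR₁0 (by positivity), fun R hR hRε => ?_⟩
  have hRR₁ : R < R₁ := hRε.trans_le (min_le_left _ _)
  have hRs : R ^ s * M ≤ C * B ^ (-s) := by
    rw [← le_div_iff₀ hM0]
    have := Real.rpow_le_rpow hR.le (hRε.trans_le (min_le_right _ _)).le hs.le
    rwa [← Real.rpow_mul (by positivity), inv_mul_cancel₀ hs.ne', Real.rpow_one] at this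
  refine hnarrow R R₁ hR hRR₁ (min_le_left _ _) ((measure_mono ?_).trans hvol) fun y hy hyx => ?_
  · exact sdiff_subset_sdiff (ball_subset_ball (min_le_right _ _))
      (closedBall_subset_closedBall hR.le)
  · have hy0 := hR₁0.trans_le hy
    have hRy : R < dist y c := hRR₁.trans_le hy
    have hM' := (hmM (inversion c R y) (closedBall_subset_closedBall
      (hRR₁.le.trans (min_le_left _ _)) (inversion_mem_closedBall hR hRy))).2
    calc kelvin s c R u y ≤ (R / dist y c) ^ s * M := by rw [kelvin]; gcongr
      _ = R ^ s * M * dist y c ^ (-s) := by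
        rw [Real.div_rpow hR.le hy0.le, Real.rpow_neg hy0.le]; ring
      _ ≤ C * B ^ (-s) * dist y c ^ (-s) := by gcongr
      _ ≤ u y := hlow' y hy hyx

/-- If the comparison holds for a radius below `|x₀ - c|`, it holds for slightly larger radii. -/
theorem exists_kelvinLE_of_kelvinLE (h : SingularRieszSolution s p x₀ u) {c : E} {R : ℝ}
    (hR : 0 < R) (hx₀ : R < dist x₀ c) (hle : KelvinLE s x₀ u c R) :
    ∃ R' > R, ∀ t, R < t → t < R' → KelvinLE s x₀ u c t := by
  have hs := h.s_pos
  set R₀ := (R + dist x₀ c) / 2 with hR₀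
  have hR₀0 : 0 < R₀ := by positivity
  have hR₀x : R₀ < dist x₀ c := by linarith
  have hRR₀ : R < R₀ := by linarith
  obtain ⟨δ, hδ, hnarrow⟩ := h.exists_narrow_region hR₀0 hR₀x
  obtain ⟨η, hη, hvol⟩ := exists_volume_annulus_le c R hδ
  set R₁ := min R₀ (R + η) with hR₁
  have hRR₁ : R < R₁ := lt_min hRR₀ (by linarith)
  have hR₁0 : 0 < R₁ := hR.trans hRR₁
  have hR₁R₀ : R₁ ≤ R₀ := min_le_left _ _
  obtain ⟨ε, hε, hstrict⟩ := h.exists_kelvin_add_le hR hx₀ hle hRR₁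
  -- `|y - c|ˢ` times the Kelvin transform at `y` is a continuous function of the radius `t` and of
  -- `ξ = (y - c) / |y - c|²`, which stays in a compact set
  set H : ℝ × E → ℝ := fun q => q.1 ^ s * u (q.1 ^ 2 • q.2 + c) with hH
  set Q : Set (ℝ × E) := Icc R R₁ ×ˢ closedBall (0 : E) (1 / R₁) with hQ
  have hcont : ContinuousOn H Q := by
    refine ContinuousOn.mul ?_ ?_
    · exact continuousOn_fst.rpow_const fun q hq => Or.inr hs.le
    · refine h.continuousOn.comp (by fun_prop) ?_
      rintro ⟨t, ξ⟩ ⟨ht, hξ⟩ heq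
      have heq' : t ^ 2 • ξ + c = x₀ := heq
      have ht' : t ≤ R₁ := ht.2
      have ht0 : 0 ≤ t := hR.le.trans ht.1
      have hξ' : ‖ξ‖ ≤ 1 / R₁ := mem_closedBall_zero_iff.1 hξ
      have : dist x₀ c ≤ R₁ := by
        rw [← heq', dist_eq_norm, add_sub_cancel_right, norm_smul,
          Real.norm_of_nonneg (by positivity)]
        calc t ^ 2 * ‖ξ‖ ≤ R₁ ^ 2 * (1 / R₁) := by gcongr
          _ = R₁ := by field_simp
      linarith
  have hunif := ((isCompact_Icc.prod (isCompact_closedBall (0 : E) (1 / R₁))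
    ).uniformContinuousOn_of_continuous hcont)
  obtain ⟨τ, hτ, hclose⟩ := Metric.uniformContinuousOn_iff.1 hunif ε hε
  refine ⟨min R₁ (R + τ), lt_min hRR₁ (by linarith), fun t ht ht' => ?_⟩
  have ht0 : 0 < t := hR.trans ht
  have htR₁ : t < R₁ := ht'.trans_le (min_le_left _ _)
  have htτ : t < R + τ := ht'.trans_le (min_le_right _ _)
  refine hnarrow t R₁ ht0 htR₁ hR₁R₀ ((measure_mono ?_).trans hvol) fun y hy hyx => ?_
  · exact sdiff_subset_sdiff (ball_subset_ball (min_le_right _ _))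
      (closedBall_subset_closedBall ht.le)
  · have hy0 := hR₁0.trans_le hy
    set ξ : E := (dist y c ^ 2)⁻¹ • (y - c) with hξ
    have hξn : ξ ∈ closedBall (0 : E) (1 / R₁) := by
      rw [mem_closedBall_zero_iff, hξ, norm_smul, Real.norm_of_nonneg (by positivity),
        ← dist_eq_norm]
      calc (dist y c ^ 2)⁻¹ * dist y c = 1 / dist y c := by field_simp
        _ ≤ 1 / R₁ := by gcongr
    have hkel : ∀ q : ℝ, 0 < q → kelvin s c q u y = H (q, ξ) * dist y c ^ (-s) := by
      intro q hq
      have : inversion c q y = q ^ 2 • ξ + c := by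
        simp only [inversion, vsub_eq_sub, vadd_eq_add, hξ, smul_smul, div_eq_mul_inv,
          mul_pow, inv_pow]
      simp only [kelvin, hH]
      rw [this, Real.div_rpow hq.le hy0.le, Real.rpow_neg hy0.le]
      ring
    have hd := hclose (t, ξ) ⟨⟨ht.le, htR₁.le⟩, hξn⟩ (R, ξ) ⟨⟨le_rfl, hRR₁.le⟩, hξn⟩ (by
      rw [dist_prod_same_right, Real.dist_eq, abs_lt]
      constructor <;> linarith)
    rw [Real.dist_eq, abs_lt] at hd
    have hst := hstrict y hy hyx
    rw [hkel R hR, ← add_mul] at hst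
    rw [hkel t ht0]
    refine le_trans ?_ hst
    gcongr
    linarith [hd.2]

theorem kelvinLE_of_tendsto (h : SingularRieszSolution s p x₀ u) {c : E} {R : ℝ} (hR : 0 < R)
    (hx₀ : R < dist x₀ c) {t : ℕ → ℝ} (ht : ∀ k, KelvinLE s x₀ u c (t k))
    (hlim : Tendsto t atTop (𝓝 R)) : KelvinLE s x₀ u c R := by
  intro y hy hyx
  have hy0 := hR.trans hy
  refine le_of_tendsto (x := atTop) (f := fun k => kelvin s c (t k) u y) ?_ ?_
  · refine Tendsto.mul ?_ ?_
    · exact (hlim.div_const _).rpow_const (Or.inr h.s_pos.le)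
    · have hne := inversion_ne_of_exterior hR hx₀ hy
      refine (h.continuousOn.continuousAt (isOpen_ne.mem_nhds hne)).tendsto.comp ?_
      exact tendsto_const_nhds.inversion hlim tendsto_const_nhds (dist_pos.1 hy0)
  · filter_upwards [hlim.eventually_lt_const hy] with k hk
    exact ht k y hk hyx

/-- The spheres centred at `c` can be moved until they reach the singularity. -/
theorem kelvinLE (h : SingularRieszSolution s p x₀ u) {c : E} (hc : c ≠ x₀) {R : ℝ} (hR : 0 < R)
    (hx₀ : R < dist x₀ c) : KelvinLE s x₀ u c R := by
  obtain ⟨ε, hε, hsmall⟩ := h.exists_kelvinLE_of_small_radius hc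
  set a := min R (ε / 2) with ha
  have ha0 : 0 < a := lt_min hR (half_pos hε)
  have haε : a < ε := (min_le_right _ _).trans_lt (half_lt_self hε)
  have hsub : Icc a R ⊆ {t | KelvinLE s x₀ u c t} := by
    refine IsClosed.Icc_subset_of_forall_mem_nhdsWithin ?_ (hsmall a ha0 haε) ?_
    · refine IsSeqClosed.isClosed fun t b ht hb => ?_
      have hbI : b ∈ Icc a R :=
        isClosed_Icc.mem_of_tendsto hb (Eventually.of_forall fun k => (ht k).2)
      exact ⟨h.kelvinLE_of_tendsto (ha0.trans_le hbI.1) (hbI.2.trans_lt hx₀)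
        (fun k => (ht k).1) hb, hbI⟩
    · rintro t ⟨ht, hta, htR⟩
      obtain ⟨t', htt', hK⟩ := h.exists_kelvinLE_of_kelvinLE (ha0.trans_le hta)
        (htR.trans hx₀) ht
      filter_upwards [Ioo_mem_nhdsGT htt'] with q hq
      exact hK q hq.1 hq.2
  exact hsub ⟨min_le_left _ _, le_rfl⟩

end SingularRieszSolution

end MovingSpheres

/-! ### Radial symmetry and monotonicity -/

section Symmetry

variable {E : Type*} [NormedAddCommGroup E] [InnerProductSpace ℝ E]

/-- The reflection exchanging the points `y` and `z` (for `y ≠ z`). -/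
noncomputable def swapReflection (y z : E) : E ≃ₜ E :=
  (Homeomorph.subRight (midpoint ℝ y z)).trans
    ((ℝ ∙ (z - y))ᗮ.reflection.toHomeomorph.trans (Homeomorph.addRight (midpoint ℝ y z)))

theorem swapReflection_apply (y z w : E) : swapReflection y z w =
    (ℝ ∙ (z - y))ᗮ.reflection (w - midpoint ℝ y z) + midpoint ℝ y z := rfl

theorem dist_swapReflection (y z w w' : E) :
    dist (swapReflection y z w) (swapReflection y z w') = dist w w' := by
  rw [swapReflection_apply, swapReflection_apply, dist_add_right,
    LinearIsometryEquiv.dist_map, dist_sub_right]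

theorem swapReflection_left (y z : E) : swapReflection y z y = z := by
  have h : y - midpoint ℝ y z = (-(1 / 2) : ℝ) • (z - y) := by
    rw [midpoint_eq_smul_add]; simp only [invOf_eq_inv]; module
  rw [swapReflection_apply, h, map_smul, Submodule.reflection_orthogonalComplement_singleton_eq_neg,
    midpoint_eq_smul_add]
  simp only [invOf_eq_inv]; module

theorem swapReflection_right (y z : E) : swapReflection y z z = y := by
  have h : z - midpoint ℝ y z = (1 / 2 : ℝ) • (z - y) := by
    rw [midpoint_eq_smul_add]; simp only [invOf_eq_inv]; module
  rw [swapReflection_apply, h, map_smul, Submodule.reflection_orthogonalComplement_singleton_eq_neg,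
    midpoint_eq_smul_add]
  simp only [invOf_eq_inv]; module

/-- Two points on the same side of the mirror are closer to each other than one of them is to the
mirror image of the other. -/
theorem sq_dist_swapReflection_sub (y z w x : E) :
    (dist (swapReflection y z w) x ^ 2 - dist w x ^ 2) * dist y z ^ 2 =
      (dist y w ^ 2 - dist z w ^ 2) * (dist y x ^ 2 - dist z x ^ 2) := by
  rcases eq_or_ne y z with rfl | hyz
  · simp
  have hW : ‖z - y‖ ≠ 0 := norm_ne_zero_iff.2 (sub_ne_zero.2 hyz.symm)
  set W := z - y with hWdef
  set a := w - midpoint ℝ y z with ha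
  set b := x - midpoint ℝ y z with hb
  have hy (v : E) : dist y v ^ 2 - dist z v ^ 2 = 2 * inner ℝ W (v - midpoint ℝ y z) := by
    have h1 : y - v = -((1 / 2 : ℝ) • W + (v - midpoint ℝ y z)) := by
      rw [midpoint_eq_smul_add, hWdef]; simp only [invOf_eq_inv]; module
    have h2 : z - v = (1 / 2 : ℝ) • W - (v - midpoint ℝ y z) := by
      rw [midpoint_eq_smul_add, hWdef]; simp only [invOf_eq_inv]; module
    rw [dist_eq_norm, dist_eq_norm, h1, h2]
    generalize v - midpoint ℝ y z = v'
    rw [norm_neg, norm_add_sq_real, norm_sub_sq_real,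
      inner_smul_left]
    simp only [conj_trivial]
    ring
  have hr : swapReflection y z w - x = (w - x) - (2 * (inner ℝ W a / ‖W‖ ^ 2)) • W := by
    rw [swapReflection_apply, Submodule.reflection_orthogonal_apply, Submodule.reflection_apply,
      Submodule.starProjection_singleton]
    simp only [RCLike.ofReal_real_eq_id, id_eq]
    rw [← ha]
    have : w = a + midpoint ℝ y z := by rw [ha]; abel
    rw [this]
    module
  have hwx : w - x = a - b := by rw [ha, hb]; abel
  rw [dist_eq_norm _ x, hr, dist_eq_norm w x, norm_sub_sq_real, hy w, hy x, dist_comm y z,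
    dist_eq_norm z y, ← hWdef, ← ha, ← hb]
  clear_value W a b
  rw [inner_smul_right, norm_smul, hwx, inner_sub_left,
    real_inner_comm W a, real_inner_comm W b, mul_pow, Real.norm_eq_abs, sq_abs]
  field_simp
  ring

variable [FiniteDimensional ℝ E] [MeasurableSpace E] [BorelSpace E]

theorem measurePreserving_swapReflection (y z : E) :
    MeasurePreserving (swapReflection y z) volume volume :=
  (measurePreserving_add_right volume (midpoint ℝ y z)).comp
    ((ℝ ∙ (z - y))ᗮ.reflection.measurePreserving.comp
      (measurePreserving_sub_right volume (midpoint ℝ y z)))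

namespace SingularRieszSolution

variable {s p : ℝ} {x₀ : E} {u : E → ℝ}

/-- The spheres that do not enclose `x₀` and whose inversion maps `y` to `z` may be taken
arbitrarily large when `z` is at least as far from `x₀` as `y`; in the limit the Kelvin factor
disappears. -/
theorem le_of_dist_le (h : SingularRieszSolution s p x₀ u) {y z : E} (hy : y ≠ x₀)
    (hyz : dist y x₀ ≤ dist z x₀) : u z ≤ u y := by
  rcases eq_or_ne y z with rfl | hne
  · exact le_rfl
  have hy0 : 0 < dist y x₀ := dist_pos.2 hy
  have hX : 0 < ‖z - x₀‖ := by rw [← dist_eq_norm]; exact hy0.trans_le hyz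
  have hW : 0 < ‖z - y‖ := norm_pos_iff.2 (sub_ne_zero.2 hne.symm)
  have hinner : ‖z - y‖ ^ 2 ≤ 2 * inner ℝ (z - x₀) (z - y) := by
    have h1 : ‖y - x₀‖ ^ 2 = ‖z - x₀‖ ^ 2 - 2 * inner ℝ (z - x₀) (z - y) + ‖z - y‖ ^ 2 := by
      rw [← norm_sub_sq_real]; congr 2; abel
    have h2 : ‖y - x₀‖ ^ 2 ≤ ‖z - x₀‖ ^ 2 := by
      rw [← dist_eq_norm, ← dist_eq_norm]; gcongr
    linarith
  have hlim : Tendsto (fun k : ℕ => √((k : ℝ) / ((k : ℝ) + 1)) ^ s * u z) atTop (𝓝 (u z)) := by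
    have h1 := ((tendsto_natCast_div_add_atTop (1 : ℝ)).sqrt.rpow_const (p := s)
      (Or.inr h.s_pos.le)).mul_const (u z)
    simpa using h1
  refine le_of_tendsto hlim ?_
  filter_upwards [eventually_ge_atTop 1] with k hk
  have ht : (0 : ℝ) < k := by exact_mod_cast hk
  generalize (k : ℝ) = t at ht
  set q := √(t / (t + 1)) with hq
  have hq0 : 0 < q := Real.sqrt_pos.2 (by positivity)
  have hq2 : q ^ 2 = t / (t + 1) := Real.sq_sqrt (by positivity)
  have hq1 : q < 1 := by
    rw [hq, Real.sqrt_lt' one_pos, one_pow, div_lt_one (by positivity)]; linarith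
  set c : E := z + t • (z - y) with hc
  set R := q * ((t + 1) * ‖z - y‖) with hR
  have hR0 : 0 < R := by positivity
  have hyc : y - c = (-(t + 1)) • (z - y) := by rw [hc]; module
  have hdy : dist y c = (t + 1) * ‖z - y‖ := by
    rw [dist_eq_norm, hyc, norm_smul, norm_neg, Real.norm_of_nonneg (by positivity)]
  have hRy : R / dist y c = q := by
    rw [hdy, hR]; field_simp
  have hRlt : R < dist y c := by
    rw [hdy, hR]; exact mul_lt_of_lt_one_left (by positivity) hq1
  have hinv : inversion c R y = z := by
    simp only [inversion, vsub_eq_sub, vadd_eq_add]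
    rw [hRy, hq2, hyc, smul_smul, hc]
    have : t / (t + 1) * -(t + 1) = -t := by field_simp
    rw [this]
    module
  have hx₀ : R < dist x₀ c := by
    refine lt_of_pow_lt_pow_left₀ 2 dist_nonneg ?_
    have h1 : dist x₀ c ^ 2 =
        ‖z - x₀‖ ^ 2 + t * (2 * inner ℝ (z - x₀) (z - y)) + t ^ 2 * ‖z - y‖ ^ 2 := by
      have : c - x₀ = (z - x₀) + t • (z - y) := by rw [hc]; abel
      rw [dist_comm, dist_eq_norm, this, norm_add_sq_real, inner_smul_right, norm_smul,
        Real.norm_of_nonneg ht.le]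
      ring
    have h2 : R ^ 2 = t * (t + 1) * ‖z - y‖ ^ 2 := by
      rw [hR, mul_pow, hq2]; field_simp
    have h3 := mul_le_mul_of_nonneg_left hinner ht.le
    have h4 : 0 < ‖z - x₀‖ ^ 2 := by positivity
    rw [h1, h2]
    linarith
  have hcx : c ≠ x₀ := (dist_pos.1 (hR0.trans hx₀)).symm
  have := h.kelvinLE hcx hR0 hx₀ y hRlt hy
  rwa [kelvin, hRy, hinv] at this

/-- Strict monotonicity: comparing `u` with its reflection in the mirror exchanging `y` and `z`,
equality would force the density to be symmetric in this mirror, but it is unbounded only on one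
side. -/
theorem lt_of_dist_lt (h : SingularRieszSolution s p x₀ u) {y z : E} (hy : y ≠ x₀)
    (hyz : dist y x₀ < dist z x₀) : u z < u y := by
  by_contra! hcon
  have hs := h.s_pos
  have hy0 : 0 < dist y x₀ := dist_pos.2 hy
  have hz : z ≠ x₀ := dist_pos.1 (hy0.trans hyz)
  have hne : y ≠ z := by rintro rfl; exact lt_irrefl _ hyz
  have hd : 0 < dist y z := dist_pos.2 hne
  set ρ := swapReflection y z with hρ
  have hρm := measurePreserving_swapReflection y z
  have hyρ : ∀ w, dist y (ρ w) = dist z w := fun w => by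
    conv_lhs => rw [← swapReflection_right y z]
    exact dist_swapReflection y z z w
  have hzρ : ∀ w, dist z (ρ w) = dist y w := fun w => by
    conv_lhs => rw [← swapReflection_left y z]
    exact dist_swapReflection y z y w
  have hside : dist y x₀ ^ 2 - dist z x₀ ^ 2 < 0 := by
    have : dist y x₀ ^ 2 < dist z x₀ ^ 2 := by gcongr
    linarith
  set G : E → ℝ := fun w =>
    (u w ^ p - u (ρ w) ^ p) * (dist y w ^ (-s) - dist z w ^ (-s)) with hG
  have hswap : ∀ x x' : E, x ≠ x₀ → (∀ w, dist x (ρ w) = dist x' w) →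
      Integrable (fun w => u (ρ w) ^ p * dist x' w ^ (-s)) ∧
      u x = ∫ w, u (ρ w) ^ p * dist x' w ^ (-s) := by
    intro x x' hx hxx'
    have h1 := (hρm.integrable_comp_emb ρ.measurableEmbedding).2 (h.integrable x hx)
    have h2 := hρm.integral_comp ρ.measurableEmbedding (fun w => u w ^ p * dist x w ^ (-s))
    simp only [Function.comp_def, ← hρ, hxx'] at h1
    rw [← h.eq x hx, ← hρ] at h2
    simp only [hxx'] at h2
    exact ⟨h1, h2.symm⟩
  obtain ⟨hi1, he1⟩ := hswap y z hy hyρ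
  obtain ⟨hi2, he2⟩ := hswap z y hz hzρ
  have hj1 := h.integrable y hy
  have hj2 := h.integrable z hz
  have hGeq : G = fun w => (u w ^ p * dist y w ^ (-s) + u (ρ w) ^ p * dist z w ^ (-s)) -
      (u w ^ p * dist z w ^ (-s) + u (ρ w) ^ p * dist y w ^ (-s)) := by
    funext w; simp only [hG]; ring
  have hI1 := hj1.fun_add hi1
  have hI2 := hj2.fun_add hi2
  have hGi : Integrable G := by rw [hGeq]; exact hI1.sub hI2
  have hGint : ∫ w, G w = 2 * (u y - u z) := by
    rw [hGeq, integral_sub hI1 hI2, integral_add hj1 hi1, integral_add hj2 hi2, ← he1, ← he2,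
      ← h.eq y hy, ← h.eq z hz]
    ring
  have hG0 : 0 ≤ᵐ[volume] G := by
    filter_upwards [h.ae_ne y, h.ae_ne z, h.ae_ne x₀, h.ae_ne (ρ.symm x₀)] with w hwy hwz hwx hwρ
    have hρx : ρ w ≠ x₀ := fun e => hwρ (by rw [← e, ρ.symm_apply_apply])
    have hid := sq_dist_swapReflection_sub y z w x₀
    rw [← hρ] at hid
    rcases le_total (dist y w) (dist z w) with hle | hle
    · have h1 : dist w x₀ ≤ dist (ρ w) x₀ := by
        refine (sq_le_sq₀ dist_nonneg dist_nonneg).1 ?_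
        have h2 : dist y w ^ 2 ≤ dist z w ^ 2 := by gcongr
        have h3 : 0 ≤ (dist y w ^ 2 - dist z w ^ 2) * (dist y x₀ ^ 2 - dist z x₀ ^ 2) :=
          mul_nonneg_of_nonpos_of_nonpos (by linarith) hside.le
        rw [← hid] at h3
        linarith [nonneg_of_mul_nonneg_left h3 (by positivity)]
      have h4 := Real.rpow_le_rpow (h.pos _ hρx).le (h.le_of_dist_le hwx h1) h.p_pos.le
      have h5 : dist z w ^ (-s) ≤ dist y w ^ (-s) :=
        Real.rpow_le_rpow_of_nonpos (dist_pos.2 hwy.symm) hle (by linarith)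
      exact mul_nonneg (by linarith) (by linarith)
    · have h1 : dist (ρ w) x₀ ≤ dist w x₀ := by
        refine (sq_le_sq₀ dist_nonneg dist_nonneg).1 ?_
        have h2 : dist z w ^ 2 ≤ dist y w ^ 2 := by gcongr
        have h3 : (dist y w ^ 2 - dist z w ^ 2) * (dist y x₀ ^ 2 - dist z x₀ ^ 2) ≤ 0 :=
          mul_nonpos_of_nonneg_of_nonpos (by linarith) hside.le
        rw [← hid] at h3
        linarith [nonpos_of_mul_nonpos_left h3 (by positivity)]
      have h4 := Real.rpow_le_rpow (h.pos _ hwx).le (h.le_of_dist_le hρx h1) h.p_pos.le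
      have h5 : dist y w ^ (-s) ≤ dist z w ^ (-s) :=
        Real.rpow_le_rpow_of_nonpos (dist_pos.2 hwz.symm) hle (by linarith)
      exact mul_nonneg_of_nonpos_of_nonpos (by linarith) (by linarith)
  have hGz : ∀ᵐ w, G w = 0 :=
    (integral_eq_zero_iff_of_nonneg_ae hG0 hGi).1
      (le_antisymm (by rw [hGint]; linarith) (integral_nonneg_of_ae hG0))
  -- near `x₀` the reflected density is bounded, whereas `u` is not
  have hρx₀ : ρ x₀ ≠ x₀ := by
    intro e
    have := hyρ x₀
    rw [e] at this
    exact hyz.ne this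
  have hev : ∀ᶠ w in 𝓝 x₀, w ≠ y ∧ dist y w < dist z w ∧ ρ w ≠ x₀ ∧
      u (ρ w) < u (ρ x₀) + 1 := by
    refine Eventually.and (isOpen_ne.mem_nhds hy.symm) (Eventually.and ?_ (Eventually.and ?_ ?_))
    · exact (isOpen_lt (by fun_prop) (by fun_prop)).mem_nhds hyz
    · exact (isOpen_ne.preimage ρ.continuous).mem_nhds hρx₀
    · exact ((h.continuousOn.continuousAt (isOpen_ne.mem_nhds hρx₀)).tendsto.comp
        ρ.continuous.continuousAt).eventually_lt_const (by linarith)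
  obtain ⟨r, hr, hball⟩ := Metric.eventually_nhds_iff_ball.1 hev
  obtain ⟨z₀, hz₀, hz₀r, hz₀M⟩ := h.unbounded r hr (u (ρ x₀) + 1)
  have hnz : ∀ᶠ w in 𝓝 z₀, G w ≠ 0 := by
    filter_upwards [isOpen_ball.mem_nhds (show z₀ ∈ ball x₀ r from hz₀r),
      (h.continuousOn.continuousAt (isOpen_ne.mem_nhds hz₀)).eventually_const_lt hz₀M] with w hw hwM
    obtain ⟨hwy, hlt, hρw, hρu⟩ := hball w hw
    have h1 : u (ρ w) ^ p < u w ^ p :=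
      Real.rpow_lt_rpow (h.pos _ hρw).le (hρu.trans hwM) h.p_pos
    have h2 : dist z w ^ (-s) < dist y w ^ (-s) :=
      Real.rpow_lt_rpow_of_neg (dist_pos.2 hwy.symm) hlt (by linarith)
    exact (mul_pos (by linarith) (by linarith)).ne'
  exact (Measure.measure_pos_of_mem_nhds volume hnz).ne' (ae_iff.1 hGz)

/-- A singular solution is a strictly decreasing function of the distance to the singularity. -/
theorem exists_strictAntiOn (h : SingularRieszSolution s p x₀ u) :
    ∃ φ : ℝ → ℝ, StrictAntiOn φ (Ioi 0) ∧ ∀ x, x ≠ x₀ → u x = φ ‖x - x₀‖ := by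
  have := h.nontrivial
  obtain ⟨e, he⟩ := exists_norm_eq E zero_le_one
  have hdist : ∀ r : ℝ, 0 ≤ r → dist (x₀ + r • e) x₀ = r := fun r hr => by
    rw [dist_eq_norm, add_sub_cancel_left, norm_smul, he, mul_one, Real.norm_of_nonneg hr]
  have hne : ∀ r : ℝ, 0 < r → x₀ + r • e ≠ x₀ := fun r hr =>
    dist_pos.1 (by rw [hdist r hr.le]; exact hr)
  refine ⟨fun r => u (x₀ + r • e), fun a ha b hb hab => ?_, fun x hx => ?_⟩
  · have ha' : 0 < a := ha
    have hb' : 0 < b := hb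
    exact h.lt_of_dist_lt (hne a ha') (by rwa [hdist a ha'.le, hdist b hb'.le])
  · have hr : 0 < ‖x - x₀‖ := norm_pos_iff.2 (sub_ne_zero.2 hx)
    have hd : dist (x₀ + ‖x - x₀‖ • e) x₀ = dist x x₀ := by rw [hdist _ hr.le, dist_eq_norm]
    exact le_antisymm (h.le_of_dist_le (hne _ hr) hd.le) (h.le_of_dist_le hx hd.ge)

end SingularRieszSolution

end Symmetry

theorem theorem2p2 (n : ℕ) (α p : ℝ) (hα : 0 < α) (hαn : α < n)
    (hp : p ≤ ((n : ℝ) + α) / ((n : ℝ) - α))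
    (x₀ : EuclideanSpace ℝ (Fin n)) (u : EuclideanSpace ℝ (Fin n) → ℝ)
    (hu : IsPositiveSolutionOff n α p x₀ u)
    (hsing : ∀ z, IsSingularPoint u z ↔ z = x₀) :
    ∃ φ : ℝ → ℝ, StrictAntiOn φ (Set.Ioi 0) ∧ ∀ x, x ≠ x₀ → u x = φ ‖x - x₀‖ :=
  (hu.singularRieszSolution hα hαn hp hsing).exists_strictAntiOn
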